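/- Let $c\in\{1,0,-1\}$ and let $\tilde M^2(4c)$ be the complex space form of complex dimension $2$ and holomorphic sectional curvature $4c$, i.e. $\mathbb{C}P^2$, $\mathbb{C}^2$ or $\mathbb{C}H^2$, with complex structure $J$, metric $h$ and Kähler form $\omega=h(J\cdot,\cdot)$. For $c=\pm1$ it is the base of the Hopf fibration over $\{Z\in\mathbb{C}^3 : (Z,Z)=c\}$, where $(Z,W)=c\,z_0\bar w_0+z_1\bar w_1+z_2\bar w_2$, and $h$ makes the fibration a Riemannian submersion. Let $\Sigma$ be a compact connected oriented surface and $f:\Sigma\to\tilde M^2(4c)$ a smooth Lagrangian immersion with induced metric $g$. Regard $\Sigma$ as a Riemann surface with the complex structure determined by $g$ and the orientation, so that $g=2e^{u}\,dz\,d\bar z$ in every local complex coordinate $z$. The mean curvature form of $f$ is the $(1,0)$-form $\Phi=\phi\,dz$ with $\phi=e^{-u}\langle F_{z\bar z},JF_z\rangle$, where $F$ is a local lift of $f$ to $\{(Z,Z)=c\}$ that is horizontal for the Hopf fibration if $c=\pm1$ and $F=f$ if $c=0$, and $\langle\cdot,\cdot\rangle=\mathrm{Re}(\cdot,\cdot)$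 (the standard real inner product if $c=0$), extended complex bilinearly, with $J$ extended complex linearly. The Maslov form of $f$ is the real one-form $\sigma_H=\omega(H,\cdot)$ on $\Sigma$, where $H$ is the mean curvature vector (half the trace of the second fundamental form); it is called conformal if its $g$-dual vector field is a conformal vector field on $(\Sigma,g)$. Two immersions $f_1,f_2:\Sigma\to\tilde M^2(4c)$ are congruent if $f_2=T\circ f_1$ for a holomorphic isometry $T$ of $\tilde M^2(4c)$. Suppose that the Maslov form of $f$ is not conformal. Then there are at most two mutually noncongruent Lagrangian immersions of $\Sigma$ into $\tilde M^2(4c)$ with induced metric $g$ and mean curvature form $\Phi$: among any three such immersions two are congruent. Equivalently, $f$ has at most one Lagrangian Bonnet partner up to congruence: any two Lagrangian immersions of $\Sigma$ with induced metric $g$ and mean curvature form $\Phi$ that are not congruent to $f$ are congruent to each other. -/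

import Mathlib

open scoped Manifold ContDiff

noncomputable section

namespace LagrangianBonnet

/-! ### The complex space forms of complex dimension two, holomorphic curvature `4c`, `c = 1, 0, -1` -/

/-- Complex dimension of the vector space in which the model lives: `ℂ²` for `c = 0`, and `ℂ³`
(the total space of the Hopf fibration sits in it) for `c = 1` and `c = -1`. -/
def ambDim (c : SignType) : ℕ := if c = 0 then 2 else 3

abbrev Amb (c : SignType) : Type := Fin (ambDim c) → ℂ

/-- The diagonal entries of the Hermitian form: all equal to `1`, except that the zeroth one is
`-1` when `c = -1`. -/
def weight (c : SignType) (i : Fin (ambDim c)) : ℝ := if c = -1 ∧ (i : ℕ) = 0 then -1 else 1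

/-- The Hermitian form `(Z, W) = ∑ ± zᵢ conj wᵢ`, linear in `Z`. -/
def herm (c : SignType) (Z W : Amb c) : ℂ :=
  ∑ i, (weight c i : ℂ) * Z i * (starRingEnd ℂ) (W i)

/-- The real inner product `⟨Z, W⟩ = Re (Z, W)`. -/
def ip (c : SignType) (Z W : Amb c) : ℝ := (herm c Z W).re

/-- The curvature sign `c`, as a complex number. -/
def cval (c : SignType) : ℂ := (((c : ℤ) : ℝ) : ℂ)

/-- The total space: `ℂ²` if `c = 0`, the unit sphere `(Z, Z) = 1` of `ℂ³` if `c = 1`, and the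
anti-de Sitter space `(Z, Z) = -1` if `c = -1`. -/
def totalSpace (c : SignType) : Set (Amb c) := {Z | c ≠ 0 → herm c Z Z = cval c}

theorem herm_smul_smul (c : SignType) (a : ℂ) (ha : ‖a‖ = 1) (Z W : Amb c) :
    herm c (a • Z) (a • W) = herm c Z W := by
  have h1 : a * (starRingEnd ℂ) a = 1 := by
    rw [Complex.mul_conj, Complex.normSq_eq_norm_sq, ha]; simp
  unfold herm
  refine Finset.sum_congr rfl fun i _ => ?_
  simp only [Pi.smul_apply, smul_eq_mul, map_mul]
  linear_combination ((weight c i : ℂ) * Z i * (starRingEnd ℂ) (W i)) * h1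

/-- Two points of the total space are identified when they differ by a unit scalar; for `c = 0`
nothing is identified. -/
def phaseSetoid (c : SignType) : Setoid (totalSpace c) where
  r Z W := ∃ a : ℂ, ‖a‖ = 1 ∧ (c = 0 → a = 1) ∧ (W : Amb c) = a • (Z : Amb c)
  iseqv :=
    { refl := fun Z => ⟨1, by simp, fun _ => rfl, by simp⟩
      symm := by
        rintro Z W ⟨a, ha, h0, h⟩
        have hne : a ≠ 0 := by rintro rfl; simp at ha
        refine ⟨a⁻¹, by simp [ha], fun hc => by simp [h0 hc], ?_⟩
        rw [h, smul_smul, inv_mul_cancel₀ hne, one_smul]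
      trans := by
        rintro Z W V ⟨a, ha, ha0, h⟩ ⟨b, hb, hb0, h'⟩
        refine ⟨b * a, by simp [ha, hb], fun hc => by simp [ha0 hc, hb0 hc], ?_⟩
        rw [h', h, smul_smul] }

/-- The complex space form of holomorphic sectional curvature `4c`: `ℂ²` for `c = 0`, the complex
projective plane for `c = 1`, the complex hyperbolic plane for `c = -1`. -/
def SpaceForm (c : SignType) : Type := Quotient (phaseSetoid c)

/-- The Hopf fibration (for `c = 0`, the identification of `ℂ²` with itself). -/
def hopf {c : SignType} (Z : totalSpace c) : SpaceForm c := Quotient.mk (phaseSetoid c) Z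

/-- The horizontal part of a vector `X` tangent to the total space at `Z`, i.e. the component
Hermitian-orthogonal to `Z`; for `c = 0` it is `X` itself. The differential of the Hopf fibration
identifies the horizontal space with the tangent space of the space form at `[Z]`. -/
def hor (c : SignType) (Z X : Amb c) : Amb c := X - (cval c * herm c X Z) • Z

/-- The Fubini–Study metric (flat for `c = 0`), computed in the total space:
the Hopf fibration is a Riemannian submersion. -/
def fsMetric (c : SignType) (Z X Y : Amb c) : ℝ := ip c (hor c Z X) (hor c Z Y)

/-- The Kähler form `ω(X, Y) = h(JX, Y)`, computed in the total space. -/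
def kahlerForm (c : SignType) (Z X Y : Amb c) : ℝ :=
  ip c (Complex.I • hor c Z X) (hor c Z Y)

/-- A rigid motion, i.e. a holomorphic isometry of the space form: a unitary map `Z ↦ A Z + b` of
`ℂ²` for `c = 0`, and an element of `U(3)` or `U(1,2)` acting on lines for `c = 1`, `c = -1`. -/
structure RigidMotion (c : SignType) where
  A : Amb c ≃ₗ[ℂ] Amb c
  b : Amb c
  isometry : ∀ Z W, herm c (A Z) (A W) = herm c Z W
  translation : c ≠ 0 → b = 0

/-- The action of a rigid motion on the total space. -/
def RigidMotion.onTotal {c : SignType} (T : RigidMotion c) (Z : totalSpace c) : totalSpace c :=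
  ⟨T.A Z + T.b, fun hc => by
    rw [T.translation hc, add_zero, T.isometry]
    exact Z.2 hc⟩

/-- The action of a rigid motion on the space form. -/
def RigidMotion.act {c : SignType} (T : RigidMotion c) : SpaceForm c → SpaceForm c :=
  Quotient.map T.onTotal (by
    rintro Z W ⟨a, ha, h0, h⟩
    refine ⟨a, ha, h0, ?_⟩
    change T.A W + T.b = a • (T.A Z + T.b)
    rw [h, map_smul]
    by_cases hc : c = 0
    · rw [h0 hc, one_smul, one_smul]
    · rw [T.translation hc, add_zero, add_zero])

/-! ### Quantities attached to a map `G : ℂ → Amb c`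

`G` is a local lift of an immersion, expressed in a complex coordinate `z = x + iy`. -/

/-- The pulled back metric on tangent vectors `v`, `w` at `z`. -/
def pullMetric {c : SignType} (G : ℂ → Amb c) (z v w : ℂ) : ℝ :=
  fsMetric c (G z) (fderiv ℝ G z v) (fderiv ℝ G z w)

/-- The pulled back Kähler form on tangent vectors `v`, `w` at `z`. -/
def pullKahler {c : SignType} (G : ℂ → Amb c) (z v w : ℂ) : ℝ :=
  kahlerForm c (G z) (fderiv ℝ G z v) (fderiv ℝ G z w)

/-- `∂G/∂x`. -/
def dx {c : SignType} (G : ℂ → Amb c) (z : ℂ) : Amb c := fderiv ℝ G z 1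

/-- `∂G/∂y`. -/
def dy {c : SignType} (G : ℂ → Amb c) (z : ℂ) : Amb c := fderiv ℝ G z Complex.I

/-- `∂²G/∂x² + ∂²G/∂y²`. -/
def lap {c : SignType} (G : ℂ → Amb c) (z : ℂ) : Amb c := dx (dx G) z + dy (dy G) z

/-- The conformal factor `e^u`: for a metric `g = 2 e^u dz dz̄ = 2 e^u (dx² + dy²)` one has
`g(∂ₓ, ∂ₓ) = g(∂ᵧ, ∂ᵧ) = 2 e^u`. -/
def expU {c : SignType} (G : ℂ → Amb c) (z : ℂ) : ℝ :=
  (pullMetric G z 1 1 + pullMetric G z Complex.I Complex.I) / 4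

/-- The coefficient `φ = e^{-u} ⟨G_{z z̄}, J G_z⟩` of the mean curvature form `Φ = φ dz`, for a
horizontal lift `G`. The inner product is extended complex bilinearly and `J` complex linearly to
the complexification, where `G_{z z̄} = (G_xx + G_yy) / 4` and `G_z = (G_x - i G_y) / 2`; the `i` in
`G_z` is the one of the complexification, while `J` is multiplication by `i` in `Amb c`. -/
def phi {c : SignType} (G : ℂ → Amb c) (z : ℂ) : ℂ :=
  ((8 * expU G z)⁻¹ : ℝ) *
    ((ip c (lap G z) (Complex.I • dx G z) : ℂ)
      - Complex.I * (ip c (lap G z) (Complex.I • dy G z) : ℂ))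

/-- The normal part of a vector `X` along a conformal Lagrangian `G`: the normal space has
the orthogonal basis `J G_x`, `J G_y`, both of square length `2 e^u`. -/
def normalPart {c : SignType} (G : ℂ → Amb c) (z : ℂ) (X : Amb c) : Amb c :=
  (2 * expU G z)⁻¹ • (ip c X (Complex.I • dx G z) • (Complex.I • dx G z)
    + ip c X (Complex.I • dy G z) • (Complex.I • dy G z))

/-- The (horizontal lift of the) mean curvature vector: half the trace, with respect to
`g = 2 e^u (dx² + dy²)`, of the second fundamental form. -/
def meanCurvatureVector {c : SignType} (G : ℂ → Amb c) (z : ℂ) : Amb c :=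
  (4 * expU G z)⁻¹ • normalPart G z (lap G z)

/-- The Maslov form `σ_H = ω(H, ·)`. -/
def maslovForm {c : SignType} (G : ℂ → Amb c) (z v : ℂ) : ℝ :=
  kahlerForm c (G z) (meanCurvatureVector G z) (fderiv ℝ G z v)

/-- The vector field metrically dual to the Maslov form, for the metric `2 e^u (dx² + dy²)`;
the vector `a ∂ₓ + b ∂ᵧ` is written `a + i b`. -/
def maslovField {c : SignType} (G : ℂ → Amb c) (z : ℂ) : ℂ :=
  ((2 * expU G z)⁻¹ : ℝ) * ((maslovForm G z 1 : ℂ) + Complex.I * (maslovForm G z Complex.I : ℂ))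

/-- The Lie derivative of the pulled back metric along the vector field `X`, evaluated at the
tangent vectors `v`, `w`. -/
def lieMetric {c : SignType} (G : ℂ → Amb c) (X : ℂ → ℂ) (z v w : ℂ) : ℝ :=
  fderiv ℝ (fun y => pullMetric G y v w) z (X z)
    + pullMetric G z (fderiv ℝ X z v) w + pullMetric G z v (fderiv ℝ X z w)

/-! ### Lagrangian immersions of a Riemann surface into a space form -/

section Surface

variable {S : Type*} [TopologicalSpace S] [ChartedSpace ℂ S] {c : SignType}

/-- `F` is a smooth lift of `f` to the total space over the open set `U` (the values of `F`
outside `U` are irrelevant). -/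
structure IsLocalLift (f : S → SpaceForm c) (U : Set S) (F : S → Amb c) : Prop where
  isOpen : IsOpen U
  smooth : ∀ e ∈ atlas ℂ S, ContDiffOn ℝ ∞ (F ∘ e.symm) (e.target ∩ e.symm ⁻¹' U)
  lift : ∀ p ∈ U, ∃ h : F p ∈ totalSpace c, f p = hopf ⟨F p, h⟩

/-- A local lift is horizontal when its derivative is orthogonal to the fibres, `⟨dF, J F⟩ = 0`;
for `c = 0` there is no condition. -/
structure IsHorizontalLift (f : S → SpaceForm c) (U : Set S) (F : S → Amb c) : Prop
    extends IsLocalLift f U F where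
  horizontal : c ≠ 0 → ∀ e ∈ atlas ℂ S, ∀ p ∈ U ∩ e.source, ∀ v : ℂ,
    ip c (fderiv ℝ (F ∘ e.symm) (e p) v) (Complex.I • F p) = 0

/-- `f` is a smooth Lagrangian immersion. Smoothness is the existence of smooth local lifts to the
total space; the differential of `f` is the horizontal part of that of a lift, and it is injective;
the Kähler form pulls back to zero. -/
structure IsLagrangianImmersion (f : S → SpaceForm c) : Prop where
  smooth : ∀ p : S, ∃ U F, p ∈ U ∧ IsLocalLift f U F
  immersion : ∀ U F, IsLocalLift f U F → ∀ e ∈ atlas ℂ S, ∀ p ∈ U ∩ e.source, ∀ v : ℂ,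
    v ≠ 0 → hor c (F p) (fderiv ℝ (F ∘ e.symm) (e p) v) ≠ 0
  lagrangian : ∀ U F, IsLocalLift f U F → ∀ e ∈ atlas ℂ S, ∀ p ∈ U ∩ e.source, ∀ v w : ℂ,
    pullKahler (F ∘ e.symm) (e p) v w = 0

/-- The complex structure of `S` is the one that the metric induced by `f` determines: in every
complex coordinate of `S` the induced metric is `2 e^u dz dz̄ = 2 e^u (dx² + dy²)`. -/
def IsConformal (f : S → SpaceForm c) : Prop :=
  ∀ U F, IsLocalLift f U F → ∀ e ∈ atlas ℂ S, ∀ p ∈ U ∩ e.source, ∃ u : ℝ, ∀ v w : ℂ,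
    pullMetric (F ∘ e.symm) (e p) v w = 2 * Real.exp u * (v * (starRingEnd ℂ) w).re

/-- `f` and `f'` induce the same metric on `S`. -/
def SameInducedMetric (f f' : S → SpaceForm c) : Prop :=
  ∀ U F, IsLocalLift f U F → ∀ U' F', IsLocalLift f' U' F' →
    ∀ e ∈ atlas ℂ S, ∀ p ∈ U ∩ U' ∩ e.source, ∀ v w : ℂ,
      pullMetric (F ∘ e.symm) (e p) v w = pullMetric (F' ∘ e.symm) (e p) v w

/-- The form `Φ` of type `(1,0)` on `S` is the mean curvature form of `f`: it is `φ dz` in every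
complex coordinate `z` of `S`, with `φ` computed from horizontal lifts of `f`. -/
def HasMeanCurvatureForm (f : S → SpaceForm c)
    (Φ : ∀ p : S, TangentSpace 𝓘(ℂ) p →L[ℂ] ℂ) : Prop :=
  ∀ U F, IsHorizontalLift f U F → ∀ e ∈ atlas ℂ S, ∀ p ∈ U ∩ e.source,
    ∀ v : TangentSpace 𝓘(ℂ) p,
      Φ p v = phi (F ∘ e.symm) (e p) * (show ℂ from mfderiv 𝓘(ℂ) 𝓘(ℂ) e p v)

/-- The Maslov form of `f` is conformal: the dual vector field is a conformal vector field, i.e.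
the Lie derivative of the induced metric along it is a multiple of the metric at each point. -/
def HasConformalMaslovForm (f : S → SpaceForm c) : Prop :=
  ∀ U F, IsHorizontalLift f U F → ∀ e ∈ atlas ℂ S, ∀ p ∈ U ∩ e.source, ∃ k : ℝ, ∀ v w : ℂ,
    lieMetric (F ∘ e.symm) (maslovField (F ∘ e.symm)) (e p) v w
      = k * pullMetric (F ∘ e.symm) (e p) v w

/-- Congruence: the maps differ by a rigid motion of the ambient space form. -/
def Congruent (f f' : S → SpaceForm c) : Prop :=
  ∃ T : RigidMotion c, ∀ p, f' p = T.act (f p)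

/-- `f'` is a Lagrangian immersion of `S` which is isometric for the metric induced by `f` and has
mean curvature form `Φ`. -/
structure IsIsometricLagrangianWith (f : S → SpaceForm c)
    (Φ : ∀ p : S, TangentSpace 𝓘(ℂ) p →L[ℂ] ℂ) (f' : S → SpaceForm c) : Prop where
  lagrangian : IsLagrangianImmersion f'
  isometric : SameInducedMetric f f'
  meanCurvature : HasMeanCurvatureForm f' Φ

/-- `f'` is a Lagrangian Bonnet partner of `f` (whose mean curvature form is `Φ`). -/
structure IsBonnetPartner (f : S → SpaceForm c)
    (Φ : ∀ p : S, TangentSpace 𝓘(ℂ) p →L[ℂ] ℂ) (f' : S → SpaceForm c) : Prop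
    extends IsIsometricLagrangianWith f Φ f' where
  noncongruent : ¬ Congruent f f'

end Surface

end LagrangianBonnet

end

/-! Let G be a horizontal lift in a complex coordinate z, and form G_z and G_z̄ with the complex
structure of the ambient space itself. On tangent vectors the real part of the Hermitian form is the
metric and the imaginary part is, up to sign, the Kähler form. So "conformal and Lagrangian" means
that G_z and G_z̄ are orthogonal with the same square E = e^u. Together with G, when c ≠ 0, they
form an orthogonal basis of the ambient space.

The second derivatives of G in this frame involve E, p = (G_zz̄, G_z̄) = iEφ and q = (G_zz, G_z̄),
where q is the coefficient of a cubic differential Q = q dz³. The Gauss equation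
(`IsLagrangianFrame.gauss`) expresses |q|² by E, p and c. The Codazzi equation
(`IsLagrangianFrame.codazzi`) reads q_z̄ = E² ∂_z(p/E²). The dual Maslov field is X = -i p̄/E², so
holomorphic q makes X holomorphic, hence conformal (`IsLagrangianFrame.conformal_of_holomorphic`).
With E and p fixed, Q determines the immersion up to congruence, because two frames then solve the
same linear system (`exists_rigidMotion`, `IsAdmissible.congruent`).

Take three immersions with the given metric and Φ, and put h = Q₁ - Q₂, k = Q₁ - Q₃. By Codazzi
these are holomorphic; by Gauss |Q₁| = |Q₂| = |Q₃|, that is 2 Re(Q₁ h̄) = |h|² and 2 Re(Q₁ k̄) =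
|k|². If h = 0, then f₁ and f₂ are congruent. Otherwise, wherever h ≠ 0 and k = rh with r real, r² =
r. Hence k/h omits the segment [2, 3]. A bounded injective holomorphic function on the complement of
that segment, the removable singularity theorem and the maximum principle make k = mh with m
constant (`IsCubicDifferential.exists_eq_const_mul`). If m is real it is 0 or 1, and f₃ is congruent
to f₁ or f₂. If m is not real, the two equations determine Q₁/h as a constant; Q₁ is then
holomorphic and the Maslov form of f conformal, a contradiction. -/

noncomputable section

namespace LagrangianBonnet

open scoped Topology ComplexConjugate

/-! ### Wirtinger derivatives -/

section Wirtinger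

variable {V : Type*} [NormedAddCommGroup V] [NormedSpace ℝ V] [NormedSpace ℂ V]

/-- The Wirtinger derivative `∂f/∂z`. -/
def wz (f : ℂ → V) (z : ℂ) : V :=
  (2⁻¹ : ℂ) • (fderiv ℝ f z 1 - Complex.I • fderiv ℝ f z Complex.I)

/-- The Wirtinger derivative `∂f/∂z̄`. -/
def wzb (f : ℂ → V) (z : ℂ) : V :=
  (2⁻¹ : ℂ) • (fderiv ℝ f z 1 + Complex.I • fderiv ℝ f z Complex.I)

theorem wz_congr {f g : ℂ → V} {z : ℂ} (h : f =ᶠ[𝓝 z] g) : wz f z = wz g z := by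
  rw [wz, wz, h.fderiv_eq]

theorem wzb_congr {f g : ℂ → V} {z : ℂ} (h : f =ᶠ[𝓝 z] g) : wzb f z = wzb g z := by
  rw [wzb, wzb, h.fderiv_eq]

theorem fderiv_one_eq (f : ℂ → V) (z : ℂ) : fderiv ℝ f z 1 = wz f z + wzb f z := by
  rw [wz, wzb, ← smul_add]
  rw [show ∀ a b : V, a - b + (a + b) = (2 : ℂ) • a from fun a b => by rw [two_smul]; abel]
  rw [smul_smul]; norm_num

theorem fderiv_I_eq (f : ℂ → V) (z : ℂ) :
    fderiv ℝ f z Complex.I = Complex.I • (wz f z - wzb f z) := by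
  rw [wz, wzb, ← smul_sub]
  rw [show ∀ a b : V, a - b - (a + b) = (-2 : ℂ) • b from fun a b => by rw [neg_smul, two_smul]; abel]
  rw [smul_smul, smul_smul, smul_smul]
  rw [show Complex.I * 2⁻¹ * -2 * Complex.I = 1 by linear_combination -Complex.I_mul_I]
  rw [one_smul]

/-- The Wirtinger derivatives are the coefficients of `v` and `v̄` in the differential. -/
theorem wz_eq_of_fderiv {f : ℂ → V} {z : ℂ} {A B : V}
    (h : ∀ v, fderiv ℝ f z v = v • A + conj v • B) : wz f z = A ∧ wzb f z = B := by
  have e1 := h 1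
  have e2 := h Complex.I
  rw [fderiv_one_eq, map_one, one_smul, one_smul] at e1
  rw [fderiv_I_eq, Complex.conj_I, neg_smul, ← sub_eq_add_neg, ← smul_sub] at e2
  have e3 := smul_right_injective V Complex.I_ne_zero e2
  have h2 : Function.Injective fun x : V => (2 : ℂ) • x := smul_right_injective V two_ne_zero
  constructor <;> apply h2
  · simp only [two_smul]
    calc _ = (wz f z + wzb f z) + (wz f z - wzb f z) := by abel
      _ = _ := by rw [e1, show wz f z - wzb f z = A - B from e3]; abel
  · simp only [two_smul]
    calc _ = (wz f z + wzb f z) - (wz f z - wzb f z) := by abel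
      _ = _ := by rw [e1, show wz f z - wzb f z = A - B from e3]; abel

theorem _root_.ContDiffAt.fderiv_apply_const {W : Type*} [NormedAddCommGroup W] [NormedSpace ℝ W]
    {f : ℂ → W} {z : ℂ} (hf : ContDiffAt ℝ ∞ f z) (v : ℂ) :
    ContDiffAt ℝ ∞ (fun w => fderiv ℝ f w v) z :=
  (hf.fderiv_right (m := ∞) (by norm_cast)).clm_apply contDiffAt_const

theorem fderiv_comp_holomorphic {W : Type*} [NormedAddCommGroup W] [NormedSpace ℝ W] {f : ℂ → W}
    {τ : ℂ → ℂ} {z : ℂ} (hτ : DifferentiableAt ℂ τ z)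
    (hf : DifferentiableAt ℝ f (τ z)) (v : ℂ) :
    fderiv ℝ (fun w => f (τ w)) z v = fderiv ℝ f (τ z) (deriv τ z * v) := by
  have h := (hf.hasFDerivAt.comp z hτ.hasDerivAt.complexToReal_fderiv).fderiv
  rw [show (fun w => f (τ w)) = f ∘ τ from rfl, h]
  simp

variable [IsScalarTower ℝ ℂ V]

theorem fderiv_eq_wz (f : ℂ → V) (z v : ℂ) :
    fderiv ℝ f z v = v • wz f z + conj v • wzb f z := by
  have hv : v = v.re • (1 : ℂ) + v.im • Complex.I := by simp
  have hs : ∀ (r : ℝ) (x : V), r • x = (r : ℂ) • x := fun r x => by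
    rw [← algebraMap_smul ℂ r x]; rfl
  conv_lhs => rw [hv]
  rw [map_add, map_smul, map_smul, fderiv_one_eq, fderiv_I_eq, hs, hs]
  have h2 : conj v = v.re - v.im * Complex.I := by
    apply Complex.ext <;> simp
  rw [h2]
  conv_rhs => rw [← Complex.re_add_im v]
  simp only [Complex.add_re, Complex.ofReal_re, Complex.mul_re, Complex.I_re, Complex.ofReal_im,
    Complex.add_im, Complex.mul_im, Complex.I_im]
  module

theorem smul_contDiffAt {a : ℂ → ℂ} {f : ℂ → V} {z : ℂ} (ha : ContDiffAt ℝ ∞ a z)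
    (hf : ContDiffAt ℝ ∞ f z) : ContDiffAt ℝ ∞ (fun w => a w • f w) z := by
  exact ha.smul hf

theorem _root_.ContDiffAt.wz {f : ℂ → V} {z : ℂ} (hf : ContDiffAt ℝ ∞ f z) :
    ContDiffAt ℝ ∞ (wz f) z :=
  smul_contDiffAt contDiffAt_const
    ((hf.fderiv_apply_const 1).sub (smul_contDiffAt contDiffAt_const (hf.fderiv_apply_const _)))

theorem _root_.ContDiffAt.wzb {f : ℂ → V} {z : ℂ} (hf : ContDiffAt ℝ ∞ f z) :
    ContDiffAt ℝ ∞ (wzb f) z :=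
  smul_contDiffAt contDiffAt_const
    ((hf.fderiv_apply_const 1).add (smul_contDiffAt contDiffAt_const (hf.fderiv_apply_const _)))

theorem wz_wzb_comm {f : ℂ → V} {z : ℂ} (hf : ContDiffAt ℝ ∞ f z) :
    wz (wzb f) z = wzb (wz f) z := by
  have hd : ∀ v, DifferentiableAt ℝ (fun w => fderiv ℝ f w v) z := fun v =>
    (hf.fderiv_apply_const v).differentiableAt (by simp)
  have hdd : DifferentiableAt ℝ (fderiv ℝ f) z :=
    (hf.fderiv_right (m := 1) (by norm_cast)).differentiableAt (by simp)
  have happ : ∀ u v, fderiv ℝ (fun w => fderiv ℝ f w v) z u = fderiv ℝ (fderiv ℝ f) z u v := by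
    intro u v
    rw [fderiv_clm_apply hdd (by fun_prop)]
    simp
  have hsymm : fderiv ℝ (fderiv ℝ f) z Complex.I 1 = fderiv ℝ (fderiv ℝ f) z 1 Complex.I :=
    (hf.isSymmSndFDerivAt (by simp; norm_cast)).eq _ _
  have e1 : ∀ u, fderiv ℝ (wzb f) z u = (2⁻¹ : ℂ) • (fderiv ℝ (fderiv ℝ f) z u 1 +
      Complex.I • fderiv ℝ (fderiv ℝ f) z u Complex.I) := by
    intro u
    have : fderiv ℝ (wzb f) z = _ :=
      (((hd 1).hasFDerivAt.add ((hd Complex.I).hasFDerivAt.const_smul Complex.I)).const_smul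
        (2⁻¹ : ℂ)).fderiv
    rw [this]
    simp [happ]
  have e2 : ∀ u, fderiv ℝ (wz f) z u = (2⁻¹ : ℂ) • (fderiv ℝ (fderiv ℝ f) z u 1 -
      Complex.I • fderiv ℝ (fderiv ℝ f) z u Complex.I) := by
    intro u
    have : fderiv ℝ (wz f) z = _ :=
      (((hd 1).hasFDerivAt.sub ((hd Complex.I).hasFDerivAt.const_smul Complex.I)).const_smul
        (2⁻¹ : ℂ)).fderiv
    rw [this]
    simp [happ]
  rw [wz, wzb, e1, e1, e2, e2, hsymm]
  module

theorem wz_wzb_add {f g : ℂ → V} {z : ℂ} (hf : DifferentiableAt ℝ f z)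
    (hg : DifferentiableAt ℝ g z) :
    wz (fun w => f w + g w) z = wz f z + wz g z ∧ wzb (fun w => f w + g w) z = wzb f z + wzb g z := by
  refine wz_eq_of_fderiv fun v => ?_
  rw [fderiv_fun_add hf hg, add_apply, fderiv_eq_wz, fderiv_eq_wz]
  module

theorem wz_wzb_sub {f g : ℂ → V} {z : ℂ} (hf : DifferentiableAt ℝ f z)
    (hg : DifferentiableAt ℝ g z) :
    wz (fun w => f w - g w) z = wz f z - wz g z ∧ wzb (fun w => f w - g w) z = wzb f z - wzb g z := by
  refine wz_eq_of_fderiv fun v => ?_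
  rw [fderiv_fun_sub hf hg, sub_apply, fderiv_eq_wz, fderiv_eq_wz]
  module

theorem wz_wzb_smul {a : ℂ → ℂ} {f : ℂ → V} {z : ℂ} (ha : DifferentiableAt ℝ a z)
    (hf : DifferentiableAt ℝ f z) :
    wz (fun w => a w • f w) z = wz a z • f z + a z • wz f z ∧
      wzb (fun w => a w • f w) z = wzb a z • f z + a z • wzb f z := by
  refine wz_eq_of_fderiv fun v => ?_
  have h : HasFDerivAt (fun w => a w • f w) _ z := ha.hasFDerivAt.smul hf.hasFDerivAt
  rw [h.fderiv]
  simp only [add_apply, smul_apply, ContinuousLinearMap.smulRight_apply]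
  rw [fderiv_eq_wz, fderiv_eq_wz a]
  simp only [smul_eq_mul]
  module

theorem wz_wzb_comp_holomorphic {f : ℂ → V} {τ : ℂ → ℂ} {z : ℂ} (hτ : DifferentiableAt ℂ τ z)
    (hf : DifferentiableAt ℝ f (τ z)) :
    wz (fun w => f (τ w)) z = deriv τ z • wz f (τ z) ∧
      wzb (fun w => f (τ w)) z = conj (deriv τ z) • wzb f (τ z) := by
  refine wz_eq_of_fderiv fun v => ?_
  rw [fderiv_comp_holomorphic hτ hf, fderiv_eq_wz, map_mul]
  module

end Wirtinger

theorem wz_wzb_conj {f : ℂ → ℂ} {z : ℂ} (hf : DifferentiableAt ℝ f z) :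
    wz (fun w => conj (f w)) z = conj (wzb f z) ∧ wzb (fun w => conj (f w)) z = conj (wz f z) := by
  refine wz_eq_of_fderiv fun v => ?_
  have h : HasFDerivAt (fun w => conj (f w)) _ z :=
    (Complex.conjCLE.toContinuousLinearMap.hasFDerivAt).comp z hf.hasFDerivAt
  rw [h.fderiv]
  simp only [ContinuousLinearMap.comp_apply]
  rw [fderiv_eq_wz]
  simp
  ring

theorem wzb_eq_zero_of_differentiableAt {f : ℂ → ℂ} {z : ℂ} (hf : DifferentiableAt ℂ f z) :
    wz f z = deriv f z ∧ wzb f z = 0 := by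
  refine wz_eq_of_fderiv fun v => ?_
  rw [hf.hasDerivAt.complexToReal_fderiv.fderiv]
  simp [mul_comm]

theorem differentiableAt_of_wzb_eq_zero {f : ℂ → ℂ} {z : ℂ} (hf : DifferentiableAt ℝ f z)
    (h : wzb f z = 0) : DifferentiableAt ℂ f z := by
  rw [differentiableAt_complex_iff_differentiableAt_real]
  refine ⟨hf, ?_⟩
  rw [fderiv_I_eq, fderiv_one_eq, h, add_zero, sub_zero]

/-! ### The Hermitian form -/

section Herm

variable {c : SignType}

theorem herm_add_left (X Y Z : Amb c) : herm c (X + Y) Z = herm c X Z + herm c Y Z := by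
  simp only [herm, ← Finset.sum_add_distrib, Pi.add_apply]
  exact Finset.sum_congr rfl fun i _ => by ring

theorem herm_add_right (X Y Z : Amb c) : herm c X (Y + Z) = herm c X Y + herm c X Z := by
  simp only [herm, ← Finset.sum_add_distrib, Pi.add_apply, map_add]
  exact Finset.sum_congr rfl fun i _ => by ring

theorem herm_smul_left (a : ℂ) (X Y : Amb c) : herm c (a • X) Y = a * herm c X Y := by
  simp only [herm, Finset.mul_sum, Pi.smul_apply, smul_eq_mul]
  exact Finset.sum_congr rfl fun i _ => by ring

theorem herm_smul_right (a : ℂ) (X Y : Amb c) : herm c X (a • Y) = conj a * herm c X Y := by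
  simp only [herm, Finset.mul_sum, Pi.smul_apply, smul_eq_mul, map_mul]
  exact Finset.sum_congr rfl fun i _ => by ring

theorem herm_real_smul_left (a : ℝ) (X Y : Amb c) : herm c (a • X) Y = a * herm c X Y := by
  rw [← herm_smul_left]; rfl

theorem herm_real_smul_right (a : ℝ) (X Y : Amb c) : herm c X (a • Y) = a * herm c X Y := by
  have := herm_smul_right (a : ℂ) X Y
  rw [Complex.conj_ofReal] at this
  rw [← this]; rfl

theorem herm_neg_left (X Y : Amb c) : herm c (-X) Y = -herm c X Y := by
  rw [← neg_one_smul ℂ, herm_smul_left]; ring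

theorem herm_neg_right (X Y : Amb c) : herm c X (-Y) = -herm c X Y := by
  rw [← neg_one_smul ℂ Y, herm_smul_right]; simp

theorem herm_sub_left (X Y Z : Amb c) : herm c (X - Y) Z = herm c X Z - herm c Y Z := by
  rw [sub_eq_add_neg, herm_add_left, herm_neg_left]; ring

theorem herm_sub_right (X Y Z : Amb c) : herm c X (Y - Z) = herm c X Y - herm c X Z := by
  rw [sub_eq_add_neg, herm_add_right, herm_neg_right]; ring

theorem herm_conj (X Y : Amb c) : conj (herm c X Y) = herm c Y X := by
  simp only [herm, map_sum, map_mul, Complex.conj_conj, Complex.conj_ofReal]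
  exact Finset.sum_congr rfl fun i _ => by ring

theorem herm_zero_left (X : Amb c) : herm c 0 X = 0 := by simp [herm]

theorem herm_zero_right (X : Amb c) : herm c X 0 = 0 := by simp [herm]

/-- The weights are ±1, so pairing with the standard basis recovers the coordinates, also in the
indefinite case. -/
theorem eq_zero_of_herm_eq_zero {X : Amb c} (h : ∀ Y, herm c X Y = 0) : X = 0 := by
  funext i
  have := h (Pi.single i 1)
  rw [herm, Finset.sum_eq_single i] at this
  · have hw : (weight c i : ℂ) ≠ 0 := by
      unfold weight; split_ifs <;> simp
    simpa [hw] using this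
  · intro j _ hj; simp [hj]
  · simp

/-- The Hermitian form as a continuous real bilinear map. -/
def hermL (c : SignType) : Amb c →L[ℝ] Amb c →L[ℝ] ℂ :=
  (LinearMap.mk₂ ℝ (herm c) herm_add_left herm_real_smul_left herm_add_right
    herm_real_smul_right).toContinuousBilinearMap

theorem _root_.ContDiffAt.herm {A B : ℂ → Amb c} {z : ℂ} (hA : ContDiffAt ℝ ∞ A z)
    (hB : ContDiffAt ℝ ∞ B z) : ContDiffAt ℝ ∞ (fun w => herm c (A w) (B w)) z :=
  ((hermL c).contDiff.contDiffAt.comp z hA).clm_apply hB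

theorem fderiv_herm {A B : ℂ → Amb c} {z : ℂ} (hA : DifferentiableAt ℝ A z)
    (hB : DifferentiableAt ℝ B z) (v : ℂ) :
    fderiv ℝ (fun w => herm c (A w) (B w)) z v =
      herm c (fderiv ℝ A z v) (B z) + herm c (A z) (fderiv ℝ B z v) := by
  have h : HasFDerivAt (fun w => herm c (A w) (B w)) _ z :=
    (hermL c).hasFDerivAt_of_bilinear hA.hasFDerivAt hB.hasFDerivAt
  rw [h.fderiv, add_comm]
  rfl

/-- The form is conjugate linear in its second slot, so ∂ and ∂̄ are exchanged there. -/
theorem wz_wzb_herm {A B : ℂ → Amb c} {z : ℂ} (hA : DifferentiableAt ℝ A z)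
    (hB : DifferentiableAt ℝ B z) :
    wz (fun w => herm c (A w) (B w)) z = herm c (wz A z) (B z) + herm c (A z) (wzb B z) ∧
    wzb (fun w => herm c (A w) (B w)) z = herm c (wzb A z) (B z) + herm c (A z) (wz B z) := by
  refine wz_eq_of_fderiv fun v => ?_
  rw [fderiv_herm hA hB, fderiv_eq_wz, fderiv_eq_wz]
  simp only [herm_add_left, herm_add_right, herm_smul_left, herm_smul_right, smul_eq_mul,
    Complex.conj_conj]
  ring

end Herm

variable {c : SignType}

/-! ### The moving frame of a horizontal conformal Lagrangian lift -/

/-- The conformal factor `⟨G_z, G_z⟩`. -/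
def confFactor (G : ℂ → Amb c) (z : ℂ) : ℂ := herm c (wz G z) (wz G z)

/-- The coefficient of the mean curvature form, up to the factor `i e^u`. -/
def meanCoeff (G : ℂ → Amb c) (z : ℂ) : ℂ := herm c (wzb (wz G) z) (wzb G z)

/-- The coefficient of the cubic differential of a Lagrangian immersion. -/
def cubicCoeff (G : ℂ → Amb c) (z : ℂ) : ℂ := herm c (wz (wz G) z) (wzb G z)

/-- `G` is a horizontal lift, on the open set `Ω`, of a conformal Lagrangian immersion. -/
structure IsLagrangianFrame (G : ℂ → Amb c) (Ω : Set ℂ) : Prop where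
  isOpen : IsOpen Ω
  smooth : ∀ z ∈ Ω, ContDiffAt ℝ ∞ G z
  norm : c ≠ 0 → ∀ z ∈ Ω, herm c (G z) (G z) = cval c
  hor_wz : c ≠ 0 → ∀ z ∈ Ω, herm c (wz G z) (G z) = 0
  hor_wzb : c ≠ 0 → ∀ z ∈ Ω, herm c (wzb G z) (G z) = 0
  ortho : ∀ z ∈ Ω, herm c (wz G z) (wzb G z) = 0
  eq : ∀ z ∈ Ω, herm c (wzb G z) (wzb G z) = confFactor G z
  ne : ∀ z ∈ Ω, confFactor G z ≠ 0

theorem cval_zero : cval 0 = 0 := by simp [cval]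

theorem cval_sq (hc : c ≠ 0) : cval c * cval c = 1 := by
  cases c <;> simp_all [cval]

theorem cval_ne_zero (hc : c ≠ 0) : cval c ≠ 0 := fun h => by simpa [h] using cval_sq hc

theorem conj_cval : conj (cval c) = cval c := Complex.conj_ofReal _

theorem confFactor_conj (G : ℂ → Amb c) (z : ℂ) : conj (confFactor G z) = confFactor G z :=
  herm_conj _ _

theorem ambDim_ne (hc : c ≠ 0) : ambDim c = 3 := if_neg hc

/-- Pairwise orthogonal nonisotropic vectors, as many as the dimension, form a total system. -/
theorem eq_zero_of_herm_ortho {n : ℕ} (hn : n = ambDim c) (v : Fin n → Amb c)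
    (hv : ∀ i, herm c (v i) (v i) ≠ 0) (ho : ∀ i j, i ≠ j → herm c (v i) (v j) = 0) {X : Amb c}
    (hX : ∀ i, herm c X (v i) = 0) : X = 0 := by
  have hsum : ∀ (a : Fin n → ℂ) (Y : Amb c),
      herm c (∑ i, a i • v i) Y = ∑ i, a i * herm c (v i) Y := by
    intro a Y
    let φ : Amb c →+ ℂ := ⟨⟨fun X => herm c X Y, herm_zero_left Y⟩, fun A B => herm_add_left A B Y⟩
    have : φ (∑ i, a i • v i) = ∑ i, φ (a i • v i) := map_sum φ _ _
    rw [show herm c (∑ i, a i • v i) Y = φ (∑ i, a i • v i) from rfl, this]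
    exact Finset.sum_congr rfl fun i _ => herm_smul_left _ _ _
  have hli : LinearIndependent ℂ v := by
    rw [Fintype.linearIndependent_iff]
    intro a ha j
    have := hsum a (v j)
    rw [ha, herm_zero_left, Finset.sum_eq_single j (fun i _ hij => by rw [ho i j hij, mul_zero])
      (by simp)] at this
    exact (mul_eq_zero.mp this.symm).resolve_right (hv j)
  -- Independence and the dimension count give a basis; no definiteness of the form is needed.
  have hspan : Submodule.span ℂ (Set.range v) = ⊤ :=
    hli.span_eq_top_of_card_eq_finrank' (by simp [hn])
  refine eq_zero_of_herm_eq_zero fun Y => ?_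
  have hY : Y ∈ Submodule.span ℂ (Set.range v) := hspan ▸ Submodule.mem_top
  induction hY using Submodule.span_induction with
  | mem y hy => obtain ⟨i, rfl⟩ := hy; exact hX i
  | zero => exact herm_zero_right X
  | add y w _ _ h1 h2 => rw [herm_add_right, h1, h2, add_zero]
  | smul a y _ h => rw [herm_smul_right, h, mul_zero]

namespace IsLagrangianFrame

variable {G : ℂ → Amb c} {Ω : Set ℂ} {z : ℂ}

theorem mono (h : IsLagrangianFrame G Ω) {Ω' : Set ℂ} (hΩ : IsOpen Ω') (hs : Ω' ⊆ Ω) :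
    IsLagrangianFrame G Ω' :=
  ⟨hΩ, fun z hz => h.smooth z (hs hz), fun hc z hz => h.norm hc z (hs hz),
    fun hc z hz => h.hor_wz hc z (hs hz), fun hc z hz => h.hor_wzb hc z (hs hz),
    fun z hz => h.ortho z (hs hz), fun z hz => h.eq z (hs hz), fun z hz => h.ne z (hs hz)⟩

theorem eventually (h : IsLagrangianFrame G Ω) (hz : z ∈ Ω) {P : ℂ → Prop} (hP : ∀ w ∈ Ω, P w) :
    ∀ᶠ w in 𝓝 z, P w :=
  Filter.mem_of_superset (h.isOpen.mem_nhds hz) hP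

theorem ortho' (h : IsLagrangianFrame G Ω) (hz : z ∈ Ω) : herm c (wzb G z) (wz G z) = 0 := by
  rw [← herm_conj, h.ortho z hz, map_zero]

/-- For c = 0 the two derivatives already span ℂ²; for c ≠ 0 the position vector completes them to a
basis of ℂ³. -/
theorem eq_zero (h : IsLagrangianFrame G Ω) (hz : z ∈ Ω) {X : Amb c} (h1 : herm c X (wz G z) = 0)
    (h2 : herm c X (wzb G z) = 0) (h3 : c ≠ 0 → herm c X (G z) = 0) : X = 0 := by
  have e1 : herm c (wz G z) (wz G z) ≠ 0 := h.ne z hz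
  have e2 : herm c (wzb G z) (wzb G z) ≠ 0 := by rw [h.eq z hz]; exact e1
  by_cases hc : c = 0
  · refine eq_zero_of_herm_ortho (n := 2) (by rw [hc]; rfl) ![wz G z, wzb G z] ?_ ?_ (X := X) ?_
    · intro i; fin_cases i <;> simp [e1, e2]
    · intro i j hij; fin_cases i <;> fin_cases j <;> simp_all [h.ortho z hz, h.ortho' hz]
    · intro i; fin_cases i <;> simp [h1, h2]
  · have e3 : herm c (G z) (G z) ≠ 0 := by rw [h.norm hc z hz]; exact cval_ne_zero hc
    have o1 := h.hor_wz hc z hz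
    have o2 := h.hor_wzb hc z hz
    have o3 : herm c (G z) (wz G z) = 0 := by rw [← herm_conj, o1, map_zero]
    have o4 : herm c (G z) (wzb G z) = 0 := by rw [← herm_conj, o2, map_zero]
    have h3 := h3 hc
    refine eq_zero_of_herm_ortho (n := 3) (by rw [ambDim_ne hc]) ![wz G z, wzb G z, G z] ?_ ?_
      (X := X) ?_
    · intro i; fin_cases i <;> simp [e1, e2, e3]
    · have o5 := h.ortho z hz
      have o6 := h.ortho' hz
      intro i j hij
      fin_cases i <;> fin_cases j <;> first | exact absurd rfl hij | simpa
    · intro i; fin_cases i <;> simpa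

/-- Each coefficient is a pairing divided by the square of the frame vector. Since (G, G) = c = c⁻¹
for c ≠ 0, the one along G is c (X, G); the factor c also removes this term when c = 0, so one
formula serves the three geometries. -/
theorem expansion (h : IsLagrangianFrame G Ω) (hz : z ∈ Ω) (X : Amb c) :
    X = (cval c * herm c X (G z)) • G z + (confFactor G z)⁻¹ •
      (herm c X (wz G z) • wz G z + herm c X (wzb G z) • wzb G z) := by
  have e1 : herm c (wz G z) (wz G z) = confFactor G z := rfl
  have e2 := h.eq z hz
  have hne := h.ne z hz
  have o5 := h.ortho z hz
  have o6 := h.ortho' hz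
  rw [← sub_eq_zero]
  by_cases hc : c = 0
  · subst hc
    rw [cval_zero, zero_mul, zero_smul, zero_add]
    refine h.eq_zero hz ?_ ?_ (fun h => absurd rfl h)
    · rw [herm_sub_left, herm_smul_left, herm_add_left, herm_smul_left, herm_smul_left, o6, e1]
      field_simp; ring
    · rw [herm_sub_left, herm_smul_left, herm_add_left, herm_smul_left, herm_smul_left, o5, e2]
      field_simp; ring
  · have o1 := h.hor_wz hc z hz
    have o2 := h.hor_wzb hc z hz
    have o3 : herm c (G z) (wz G z) = 0 := by rw [← herm_conj, o1, map_zero]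
    have o4 : herm c (G z) (wzb G z) = 0 := by rw [← herm_conj, o2, map_zero]
    refine h.eq_zero hz ?_ ?_ (fun _ => ?_)
    · rw [herm_sub_left, herm_add_left, herm_smul_left, herm_smul_left, herm_add_left,
        herm_smul_left, herm_smul_left, o6, e1, o3]
      field_simp; ring
    · rw [herm_sub_left, herm_add_left, herm_smul_left, herm_smul_left, herm_add_left,
        herm_smul_left, herm_smul_left, o5, e2, o4]
      field_simp; ring
    · rw [herm_sub_left, herm_add_left, herm_smul_left, herm_smul_left, herm_add_left,
        herm_smul_left, herm_smul_left, o1, o2, h.norm hc z hz]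
      linear_combination -herm c X (G z) * cval_sq hc

theorem parseval (h : IsLagrangianFrame G Ω) (hz : z ∈ Ω) (X Y : Amb c) :
    herm c X Y = cval c * herm c X (G z) * conj (herm c Y (G z)) + (confFactor G z)⁻¹ *
      (herm c X (wz G z) * conj (herm c Y (wz G z)) +
        herm c X (wzb G z) * conj (herm c Y (wzb G z))) := by
  conv_lhs => rw [h.expansion hz X]
  simp only [herm_add_left, herm_smul_left, herm_conj]

section Differentiability

theorem diff (h : IsLagrangianFrame G Ω) (hz : z ∈ Ω) : DifferentiableAt ℝ G z :=
  (h.smooth z hz).differentiableAt (by simp)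

theorem diff_wz (h : IsLagrangianFrame G Ω) (hz : z ∈ Ω) : DifferentiableAt ℝ (wz G) z :=
  (h.smooth z hz).wz.differentiableAt (by simp)

theorem diff_wzb (h : IsLagrangianFrame G Ω) (hz : z ∈ Ω) : DifferentiableAt ℝ (wzb G) z :=
  (h.smooth z hz).wzb.differentiableAt (by simp)

theorem smooth_confFactor (h : IsLagrangianFrame G Ω) (hz : z ∈ Ω) :
    ContDiffAt ℝ ∞ (confFactor G) z :=
  (h.smooth z hz).wz.herm (h.smooth z hz).wz

theorem smooth_meanCoeff (h : IsLagrangianFrame G Ω) (hz : z ∈ Ω) :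
    ContDiffAt ℝ ∞ (meanCoeff G) z :=
  (h.smooth z hz).wz.wzb.herm (h.smooth z hz).wzb

theorem smooth_cubicCoeff (h : IsLagrangianFrame G Ω) (hz : z ∈ Ω) :
    ContDiffAt ℝ ∞ (cubicCoeff G) z :=
  (h.smooth z hz).wz.wz.herm (h.smooth z hz).wzb

theorem diff_cubicCoeff (h : IsLagrangianFrame G Ω) (hz : z ∈ Ω) :
    DifferentiableAt ℝ (cubicCoeff G) z :=
  (h.smooth_cubicCoeff hz).differentiableAt (by simp)

theorem wz_wzb (h : IsLagrangianFrame G Ω) (hz : z ∈ Ω) : wz (wzb G) z = wzb (wz G) z :=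
  wz_wzb_comm (h.smooth z hz)

end Differentiability

theorem wz_wzb_const {f : ℂ → ℂ} {a : ℂ} (hf : ∀ᶠ w in 𝓝 z, f w = a) :
    wz f z = 0 ∧ wzb f z = 0 := by
  rw [wz_congr (g := fun _ => a) hf, wzb_congr (g := fun _ => a) hf]
  refine wz_eq_of_fderiv fun v => ?_
  simp

/-! Components of the second derivatives in the frame. -/

/-- This is the ∂̄-derivative of (G_z, G_z̄) = 0. The other components arise likewise by
differentiating the relations that define the frame. -/
theorem herm_zzb_wz (h : IsLagrangianFrame G Ω) (hz : z ∈ Ω) :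
    herm c (wzb (wz G) z) (wz G z) = -conj (meanCoeff G z) := by
  have h1 := (wz_wzb_herm (h.diff_wz hz) (h.diff_wzb hz)).2
  rw [(wz_wzb_const (h.eventually hz h.ortho)).2, h.wz_wzb hz] at h1
  have h2 : meanCoeff G z = - herm c (wz G z) (wzb (wz G) z) := by
    rw [meanCoeff]; linear_combination -h1
  rw [h2, map_neg, herm_conj, neg_neg]

theorem herm_zz_wz (h : IsLagrangianFrame G Ω) (hz : z ∈ Ω) :
    herm c (wz (wz G) z) (wz G z) = wz (confFactor G) z + meanCoeff G z := by
  have h1 := (wz_wzb_herm (h.diff_wz hz) (h.diff_wz hz)).1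
  have h2 : herm c (wz G z) (wzb (wz G) z) = - meanCoeff G z := by
    rw [← herm_conj, h.herm_zzb_wz hz, map_neg, Complex.conj_conj]
  rw [h2] at h1
  rw [show confFactor G = fun w => herm c (wz G w) (wz G w) from rfl, h1]
  ring

theorem herm_zbzb_wz (h : IsLagrangianFrame G Ω) (hz : z ∈ Ω) :
    herm c (wzb (wzb G) z) (wz G z) = -conj (cubicCoeff G z) := by
  have h1 := (wz_wzb_herm (h.diff_wz hz) (h.diff_wzb hz)).1
  rw [(wz_wzb_const (h.eventually hz h.ortho)).1] at h1
  have h2 : cubicCoeff G z = - herm c (wz G z) (wzb (wzb G) z) := by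
    rw [cubicCoeff]; linear_combination -h1
  rw [h2, map_neg, herm_conj, neg_neg]

theorem herm_zbzb_wzb (h : IsLagrangianFrame G Ω) (hz : z ∈ Ω) :
    herm c (wzb (wzb G) z) (wzb G z) = conj (wz (confFactor G) z - meanCoeff G z) := by
  have h1 := (wz_wzb_herm (h.diff_wzb hz) (h.diff_wzb hz)).1
  rw [wz_congr (h.eventually hz h.eq), h.wz_wzb hz] at h1
  rw [← herm_conj]
  congr 1
  rw [h1, meanCoeff]
  ring

theorem herm_zz_self (h : IsLagrangianFrame G Ω) (hz : z ∈ Ω) (hc : c ≠ 0) :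
    herm c (wz (wz G) z) (G z) = 0 := by
  have h1 := (wz_wzb_herm (h.diff_wz hz) (h.diff hz)).1
  rw [(wz_wzb_const (h.eventually hz (h.hor_wz hc))).1, h.ortho z hz] at h1
  linear_combination -h1

theorem herm_zzb_self (h : IsLagrangianFrame G Ω) (hz : z ∈ Ω) (hc : c ≠ 0) :
    herm c (wzb (wz G) z) (G z) = -confFactor G z := by
  have h1 := (wz_wzb_herm (h.diff_wz hz) (h.diff hz)).2
  rw [(wz_wzb_const (h.eventually hz (h.hor_wz hc))).2] at h1
  rw [confFactor]
  linear_combination -h1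

theorem herm_zbzb_self (h : IsLagrangianFrame G Ω) (hz : z ∈ Ω) (hc : c ≠ 0) :
    herm c (wzb (wzb G) z) (G z) = 0 := by
  have h1 := (wz_wzb_herm (h.diff_wzb hz) (h.diff hz)).2
  rw [(wz_wzb_const (h.eventually hz (h.hor_wzb hc))).2, h.ortho' hz] at h1
  linear_combination -h1

/-- Pairings with G are controlled only for c ≠ 0, but they occur with the factor c. This allows
arguments without a case distinction. -/
theorem cval_mul_eq {a b : ℂ} (h : c ≠ 0 → a = b) : cval c * a = cval c * b := by
  by_cases hc : c = 0
  · subst hc; simp [cval_zero]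
  · rw [h hc]

/-! ### Structure equations of the frame and their integrability conditions -/

theorem frame_zz (h : IsLagrangianFrame G Ω) (hz : z ∈ Ω) :
    wz (wz G) z = (confFactor G z)⁻¹ • ((wz (confFactor G) z + meanCoeff G z) • wz G z +
      cubicCoeff G z • wzb G z) := by
  conv_lhs => rw [h.expansion hz (wz (wz G) z)]
  rw [h.herm_zz_wz hz, cval_mul_eq (h.herm_zz_self hz), mul_zero, zero_smul, zero_add, cubicCoeff]

theorem frame_zzb (h : IsLagrangianFrame G Ω) (hz : z ∈ Ω) :
    wzb (wz G) z = (-(cval c * confFactor G z)) • G z + (confFactor G z)⁻¹ •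
      (-conj (meanCoeff G z) • wz G z + meanCoeff G z • wzb G z) := by
  conv_lhs => rw [h.expansion hz (wzb (wz G) z)]
  rw [h.herm_zzb_wz hz, cval_mul_eq (h.herm_zzb_self hz), meanCoeff, mul_neg]

theorem frame_zbzb (h : IsLagrangianFrame G Ω) (hz : z ∈ Ω) :
    wzb (wzb G) z = (confFactor G z)⁻¹ • (-conj (cubicCoeff G z) • wz G z +
      conj (wz (confFactor G) z - meanCoeff G z) • wzb G z) := by
  conv_lhs => rw [h.expansion hz (wzb (wzb G) z)]
  rw [h.herm_zbzb_wz hz, h.herm_zbzb_wzb hz, cval_mul_eq (h.herm_zbzb_self hz), mul_zero,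
    zero_smul, zero_add]

theorem wz_confFactor_conj (h : IsLagrangianFrame G Ω) (hz : z ∈ Ω) :
    conj (wz (confFactor G) z) = wzb (confFactor G) z := by
  have h1 := (wz_wzb_conj ((h.smooth_confFactor hz).differentiableAt (by simp))).2
  rw [← h1]
  simp only [confFactor_conj]

/-- The Codazzi equation. -/
theorem codazzi (h : IsLagrangianFrame G Ω) (hz : z ∈ Ω) :
    wzb (cubicCoeff G) z =
      wz (meanCoeff G) z - 2 * meanCoeff G z * wz (confFactor G) z / confFactor G z := by
  have hs := (h.smooth z hz)
  -- q_z̄ and p_z contain the same third derivative of G paired with G_z̄. It cancels in the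
  -- difference, and Parseval evaluates the remaining products of second derivatives.
  have h1 := (wz_wzb_herm (hs.wz.wz.differentiableAt (by simp)) (h.diff_wzb hz)).2
  have h2 := (wz_wzb_herm (hs.wz.wzb.differentiableAt (by simp)) (h.diff_wzb hz)).1
  rw [h.wz_wzb hz, h.parseval hz (wz (wz G) z), h.herm_zz_wz hz, h.herm_zzb_wz hz, mul_assoc,
    cval_mul_eq (b := 0) (fun hc => by rw [h.herm_zz_self hz hc, zero_mul])] at h1
  rw [wz_wzb_comm hs.wz, h.parseval hz (wzb (wz G) z), h.herm_zzb_wz hz, h.herm_zbzb_wzb hz,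
    h.herm_zbzb_wz hz, mul_assoc,
    cval_mul_eq (b := 0) (fun hc => by rw [h.herm_zbzb_self hz hc, map_zero, mul_zero])] at h2
  rw [show cubicCoeff G = fun w => herm c (wz (wz G) w) (wzb G w) from rfl,
    show wz (meanCoeff G) z = wz (fun w => herm c (wzb (wz G) w) (wzb G w)) z from rfl, h1, h2]
  rw [show herm c (wzb (wz G) z) (wzb G z) = meanCoeff G z from rfl,
    show herm c (wz (wz G) z) (wzb G z) = cubicCoeff G z from rfl]
  simp only [map_neg, Complex.conj_conj]
  have := h.ne z hz
  field_simp
  ring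

/-- The Gauss equation: the length of the cubic differential is determined by the metric and the
mean curvature form. -/
theorem gauss (h : IsLagrangianFrame G Ω) (hz : z ∈ Ω) :
    cubicCoeff G z * conj (cubicCoeff G z) =
      confFactor G z * (wzb (fun w => wz (confFactor G) w + meanCoeff G w) z +
        wz (fun w => conj (meanCoeff G w)) z) + cval c * confFactor G z ^ 3 -
      (wz (confFactor G) z + meanCoeff G z) * conj (wz (confFactor G) z + meanCoeff G z) +
        2 * meanCoeff G z * conj (meanCoeff G z) := by
  have hs := (h.smooth z hz)
  -- Now the third derivative is paired with G_z. The companion term is (G_zz, G_zz), whose Parseval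
  -- expansion contains |q|²/E.
  have h1 := (wz_wzb_herm (hs.wz.wz.differentiableAt (by simp)) (h.diff_wz hz)).2
  have h2 := (wz_wzb_herm (hs.wz.wzb.differentiableAt (by simp)) (h.diff_wz hz)).1
  rw [h.parseval hz (wz (wz G) z), h.herm_zz_wz hz, mul_assoc,
    cval_mul_eq (b := 0) (fun hc => by rw [h.herm_zz_self hz hc, zero_mul])] at h1
  rw [wz_wzb_comm hs.wz, h.parseval hz (wzb (wz G) z), h.herm_zzb_wz hz, mul_assoc,
    cval_mul_eq (b := confFactor G z ^ 2) (fun hc => by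
      rw [h.herm_zzb_self hz hc, map_neg, confFactor_conj]; ring)] at h2
  rw [wzb_congr (h.eventually hz fun w hw => h.herm_zz_wz hw)] at h1
  have e : wz (fun w => conj (meanCoeff G w)) z =
      - wz (fun w => herm c (wzb (wz G) w) (wz G w)) z := by
    rw [wz_congr (h.eventually hz fun w hw => h.herm_zzb_wz hw)]
    have := (wz_wzb_smul (a := fun _ => (-1 : ℂ)) (f := fun w => conj (meanCoeff G w)) (z := z)
      (by fun_prop) ?_).1
    · simp only [neg_smul, one_smul] at this
      rw [this, (wz_wzb_const (f := fun _ => (-1 : ℂ)) (.of_forall fun _ => rfl)).1]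
      simp
    · exact (Complex.conjCLE.differentiableAt).comp z
        ((h.smooth_meanCoeff hz).differentiableAt (by simp))
  rw [h1, e, h2]
  rw [show herm c (wzb (wz G) z) (wzb G z) = meanCoeff G z from rfl,
    show herm c (wz (wz G) z) (wzb G z) = cubicCoeff G z from rfl]
  simp only [map_neg, Complex.conj_conj]
  have := h.ne z hz
  field_simp
  ring

end IsLagrangianFrame

/-! ### From the geometric definitions to the frame coefficients -/

theorem ip_I_right (X Y : Amb c) : ip c X (Complex.I • Y) = (herm c X Y).im := by
  rw [ip, herm_smul_right]; simp

theorem hor_eq_self {Z X : Amb c} (h : c ≠ 0 → herm c X Z = 0) : hor c Z X = X := by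
  rw [hor, IsLagrangianFrame.cval_mul_eq (b := 0) h, mul_zero, zero_smul, sub_zero]

/-- For c ≠ 0, constancy of (G, G) kills the real part of (dG, G) and horizontality the imaginary
part, so dG is its own horizontal part. The metric and Kähler conditions then give (dG v, dG w) =
2e^u Re(v w̄), and the frame relations follow by taking v, w in {1, i}. -/
theorem isLagrangianFrame_of_pull {G : ℂ → Amb c} {Ω : Set ℂ} (hΩ : IsOpen Ω)
    (hs : ∀ z ∈ Ω, ContDiffAt ℝ ∞ G z) (hn : c ≠ 0 → ∀ z ∈ Ω, herm c (G z) (G z) = cval c)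
    (hh : c ≠ 0 → ∀ z ∈ Ω, ∀ v, ip c (fderiv ℝ G z v) (Complex.I • G z) = 0)
    (hm : ∀ z ∈ Ω, ∃ u : ℝ, ∀ v w : ℂ,
      pullMetric G z v w = 2 * Real.exp u * (v * (starRingEnd ℂ) w).re)
    (hk : ∀ z ∈ Ω, ∀ v w, pullKahler G z v w = 0) : IsLagrangianFrame G Ω := by
  have hd : ∀ z ∈ Ω, DifferentiableAt ℝ G z := fun z hz => (hs z hz).differentiableAt (by simp)
  have h0 : c ≠ 0 → ∀ z ∈ Ω, ∀ v, herm c (fderiv ℝ G z v) (G z) = 0 := by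
    intro hc z hz v
    have h1 := fderiv_herm (hd z hz) (hd z hz) v
    have h2 : (fun w => herm c (G w) (G w)) =ᶠ[𝓝 z] fun _ => cval c :=
      Filter.mem_of_superset (hΩ.mem_nhds hz) (hn hc)
    rw [h2.fderiv_eq, ← herm_conj (fderiv ℝ G z v)] at h1
    have h3 := hh hc z hz v
    rw [ip_I_right] at h3
    apply Complex.ext
    · have := congrArg Complex.re h1
      simp at this
      simp; linarith
    · exact h3
  have hhor : ∀ z ∈ Ω, ∀ v, hor c (G z) (fderiv ℝ G z v) = fderiv ℝ G z v := fun z hz v =>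
    hor_eq_self fun hc => h0 hc z hz v
  have key : ∀ z ∈ Ω, ∃ e : ℝ, e ≠ 0 ∧ ∀ v w,
      herm c (fderiv ℝ G z v) (fderiv ℝ G z w) = 2 * e * ((v * conj w).re : ℝ) := by
    intro z hz
    obtain ⟨u, hu⟩ := hm z hz
    refine ⟨Real.exp u, (Real.exp_pos u).ne', fun v w => ?_⟩
    have h1 := hu v w
    have h2 := hk z hz v w
    rw [pullMetric, fsMetric, hhor z hz, hhor z hz, ip] at h1
    rw [pullKahler, kahlerForm, hhor z hz, hhor z hz, ip, herm_smul_left] at h2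
    apply Complex.ext
    · rw [h1, ← Complex.ofReal_ofNat, ← Complex.ofReal_mul, ← Complex.ofReal_mul, Complex.ofReal_re]
    · simp at h2; rw [h2]; simp
  have key2 : ∀ z ∈ Ω, ∃ e : ℂ, e ≠ 0 ∧ herm c (wz G z) (wz G z) = e ∧
      herm c (wz G z) (wzb G z) = 0 ∧ herm c (wzb G z) (wzb G z) = e := by
    intro z hz
    obtain ⟨e, he, h⟩ := key z hz
    have h11 := h 1 1
    have h1I := h 1 Complex.I
    have hI1 := h Complex.I 1
    have hII := h Complex.I Complex.I
    simp at h11 h1I hI1 hII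
    have c2 : conj (2⁻¹ : ℂ) = 2⁻¹ := by rw [map_inv₀, map_ofNat]
    refine ⟨e, by exact_mod_cast he, ?_, ?_, ?_⟩ <;>
      simp only [wz, wzb, herm_smul_left, herm_smul_right, herm_add_left, herm_add_right,
        herm_sub_left, herm_sub_right, h11, h1I, hI1, hII, c2, Complex.conj_I]
    · linear_combination (-(e : ℂ) / 2) * Complex.I_mul_I
    · linear_combination ((e : ℂ) / 2) * Complex.I_mul_I
    · linear_combination (-(e : ℂ) / 2) * Complex.I_mul_I
  refine ⟨hΩ, hs, hn, ?_, ?_, ?_, ?_, ?_⟩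
  · intro hc z hz
    rw [wz, herm_smul_left, herm_sub_left, herm_smul_left, h0 hc z hz, h0 hc z hz]; simp
  · intro hc z hz
    rw [wzb, herm_smul_left, herm_add_left, herm_smul_left, h0 hc z hz, h0 hc z hz]; simp
  · intro z hz
    obtain ⟨e, he, h1, h2, h3⟩ := key2 z hz
    exact h2
  · intro z hz
    obtain ⟨e, he, h1, h2, h3⟩ := key2 z hz
    rw [h3, confFactor, h1]
  · intro z hz
    obtain ⟨e, he, h1, h2, h3⟩ := key2 z hz
    rwa [confFactor, h1]

namespace IsLagrangianFrame

variable {G : ℂ → Amb c} {Ω : Set ℂ} {z : ℂ}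

theorem herm_fderiv_self (h : IsLagrangianFrame G Ω) (hz : z ∈ Ω) (hc : c ≠ 0) (v : ℂ) :
    herm c (fderiv ℝ G z v) (G z) = 0 := by
  rw [fderiv_eq_wz, herm_add_left, herm_smul_left, herm_smul_left, h.hor_wz hc z hz,
    h.hor_wzb hc z hz, mul_zero, mul_zero, add_zero]

theorem herm_fderiv (h : IsLagrangianFrame G Ω) (hz : z ∈ Ω) (v w : ℂ) :
    herm c (fderiv ℝ G z v) (fderiv ℝ G z w) = confFactor G z * (2 * (v * conj w).re : ℝ) := by
  have e1 : herm c (wz G z) (wz G z) = confFactor G z := rfl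
  have : ((2 * (v * conj w).re : ℝ) : ℂ) = v * conj w + conj (v * conj w) := by
    rw [Complex.add_conj]
  rw [fderiv_eq_wz, fderiv_eq_wz, this, map_mul, Complex.conj_conj]
  simp only [herm_add_left, herm_add_right, herm_smul_left, herm_smul_right, e1, h.eq z hz,
    h.ortho z hz, h.ortho' hz, Complex.conj_conj]
  ring

theorem confFactor_eq_re : ((confFactor G z).re : ℂ) = confFactor G z :=
  Complex.conj_eq_iff_re.mp (confFactor_conj G z)

theorem hor_fderiv (h : IsLagrangianFrame G Ω) (hz : z ∈ Ω) (v : ℂ) :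
    hor c (G z) (fderiv ℝ G z v) = fderiv ℝ G z v :=
  hor_eq_self fun hc => h.herm_fderiv_self hz hc v

theorem pullMetric_eq (h : IsLagrangianFrame G Ω) (hz : z ∈ Ω) (v w : ℂ) :
    pullMetric G z v w = (confFactor G z).re * (2 * (v * conj w).re) := by
  rw [pullMetric, fsMetric, h.hor_fderiv hz, h.hor_fderiv hz, ip, h.herm_fderiv hz,
    Complex.re_mul_ofReal]

theorem expU_eq (h : IsLagrangianFrame G Ω) (hz : z ∈ Ω) : expU G z = (confFactor G z).re := by
  rw [expU, h.pullMetric_eq hz, h.pullMetric_eq hz]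
  simp
  ring

theorem expU_ne (h : IsLagrangianFrame G Ω) (hz : z ∈ Ω) : expU G z ≠ 0 := by
  rw [h.expU_eq hz]
  intro h0
  apply h.ne z hz
  rw [← confFactor_eq_re, h0, Complex.ofReal_zero]

theorem lap_eq (h : IsLagrangianFrame G Ω) (hz : z ∈ Ω) : lap G z = (4 : ℂ) • wzb (wz G) z := by
  have hx : dx G = fun w => wz G w + wzb G w := funext fun w => fderiv_one_eq G w
  have hy : dy G = fun w => Complex.I • (wz G w - wzb G w) := funext fun w => fderiv_I_eq G w
  have d1 := h.diff_wz hz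
  have d2 := h.diff_wzb hz
  have s1 : fderiv ℝ (fun w => Complex.I • (wz G w - wzb G w)) z =
    Complex.I • fderiv ℝ (fun w => (wz G w - wzb G w)) z := fderiv_fun_const_smul (d1.sub d2) _
  rw [lap, hx, hy, dx, dy, s1, fderiv_fun_add d1 d2, fderiv_fun_sub d1 d2]
  simp only [add_apply, smul_apply, sub_apply, fderiv_one_eq, fderiv_I_eq, h.wz_wzb hz]
  rw [← smul_sub, smul_smul, Complex.I_mul_I]
  module

theorem herm_lap_dx (h : IsLagrangianFrame G Ω) (hz : z ∈ Ω) :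
    ip c (lap G z) (Complex.I • dx G z) = 8 * (meanCoeff G z).im := by
  rw [ip_I_right, h.lap_eq hz, dx, fderiv_one_eq, herm_smul_left, herm_add_right,
    h.herm_zzb_wz hz, ← meanCoeff]
  simp
  ring

theorem herm_lap_dy (h : IsLagrangianFrame G Ω) (hz : z ∈ Ω) :
    ip c (lap G z) (Complex.I • dy G z) = 8 * (meanCoeff G z).re := by
  rw [ip_I_right, h.lap_eq hz, dy, fderiv_I_eq, herm_smul_left, herm_smul_right, herm_sub_right,
    h.herm_zzb_wz hz, ← meanCoeff]
  simp
  ring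

/-- The definition of φ uses the i of the complexification, whereas p uses J. This formula is the
bridge: with E known, φ and p determine each other. -/
theorem phi_eq (h : IsLagrangianFrame G Ω) (hz : z ∈ Ω) :
    phi G z = -Complex.I * meanCoeff G z / confFactor G z := by
  rw [phi, h.herm_lap_dx hz, h.herm_lap_dy hz, ← confFactor_eq_re, ← h.expU_eq hz]
  have : (expU G z : ℂ) ≠ 0 := by exact_mod_cast h.expU_ne hz
  conv_rhs => rw [← Complex.re_add_im (meanCoeff G z)]
  push_cast
  field_simp
  linear_combination ((meanCoeff G z).im : ℂ) * Complex.I_mul_I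

theorem maslovForm_eq (h : IsLagrangianFrame G Ω) (hz : z ∈ Ω) (v : ℂ) :
    maslovForm G z v = -(2 * (expU G z)⁻¹) * (v * meanCoeff G z).im := by
  have hH : c ≠ 0 → herm c (meanCurvatureVector G z) (G z) = 0 := by
    intro hc
    simp only [meanCurvatureVector, normalPart, herm_real_smul_left, herm_add_left, herm_smul_left,
      dx, dy, h.herm_fderiv_self hz hc, mul_zero, add_zero]
  have hne := h.expU_ne hz
  rw [maslovForm, kahlerForm, hor_eq_self hH, h.hor_fderiv hz, ip]
  simp only [meanCurvatureVector, normalPart, herm_real_smul_left, herm_add_left, herm_smul_left,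
      h.herm_lap_dx hz, h.herm_lap_dy hz]
  rw [dx, dy, h.herm_fderiv hz, h.herm_fderiv hz, ← confFactor_eq_re, ← h.expU_eq hz]
  simp
  field_simp
  ring

theorem maslovField_eq (h : IsLagrangianFrame G Ω) (hz : z ∈ Ω) :
    maslovField G z = -Complex.I * conj (meanCoeff G z) / confFactor G z ^ 2 := by
  rw [maslovField, h.maslovForm_eq hz, h.maslovForm_eq hz, ← confFactor_eq_re, ← h.expU_eq hz]
  have : (expU G z : ℂ) ≠ 0 := by exact_mod_cast h.expU_ne hz
  apply Complex.ext
  · simp [← Complex.ofReal_pow]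
    field_simp
  · simp [← Complex.ofReal_pow]
    field_simp

/-- The Maslov form is conformal wherever the cubic differential is holomorphic. -/
theorem conformal_of_holomorphic (h : IsLagrangianFrame G Ω) (hz : z ∈ Ω)
    (hq : wzb (cubicCoeff G) z = 0) : ∃ k : ℝ, ∀ v w : ℂ,
      lieMetric G (maslovField G) z v w = k * pullMetric G z v w := by
  have hE := h.smooth_confFactor hz
  have hp := h.smooth_meanCoeff hz
  have hne := h.ne z hz
  -- A holomorphic vector field is conformal for every metric conformal to |dz|². It remains to see
  -- that ∂̄X = 0 for X = -i p̄/E².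
  have hX : DifferentiableAt ℂ (maslovField G) z := by
    have hcp : ContDiffAt ℝ ∞ (fun w => conj (meanCoeff G w)) z :=
      (Complex.conjCLE.contDiff.contDiffAt).comp z hp
    have hXd : DifferentiableAt ℝ (maslovField G) z := by
      have : maslovField G =ᶠ[𝓝 z]
          fun w => -Complex.I * conj (meanCoeff G w) / confFactor G w ^ 2 :=
        h.eventually hz fun w hw => h.maslovField_eq hw
      refine DifferentiableAt.congr_of_eventuallyEq ?_ this
      have dE := hE.differentiableAt (by simp)
      have dcp := hcp.differentiableAt (by simp)
      have hne2 : confFactor G z ^ 2 ≠ 0 := pow_ne_zero 2 hne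
      simp only [div_eq_mul_inv]
      exact (dcp.const_mul (-Complex.I)).mul (DifferentiableAt.inv (dE.fun_pow 2) hne2)
    refine differentiableAt_of_wzb_eq_zero hXd ?_
    -- Differentiating E²X = -i p̄ avoids the derivative of a quotient.
    have e : (fun w => (confFactor G w * confFactor G w) • maslovField G w) =ᶠ[𝓝 z]
        fun w => (-Complex.I) • conj (meanCoeff G w) := h.eventually hz fun w hw => by
      have := h.ne w hw
      simp only [smul_eq_mul]
      rw [h.maslovField_eq hw]
      field_simp
    have dE := hE.differentiableAt (by simp)
    have dEE : DifferentiableAt ℝ (fun w => confFactor G w * confFactor G w) z := dE.mul dE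
    have h1 := (wz_wzb_smul dEE hXd).2
    have h2 := (wz_wzb_smul dE dE).2
    have h3 := (wz_wzb_smul (a := fun _ => -Complex.I) (z := z) (by fun_prop)
      (hcp.differentiableAt (by simp))).2
    simp only [smul_eq_mul] at h1 h2 h3 e
    rw [(wz_wzb_const (f := fun _ => -Complex.I) (.of_forall fun _ => rfl)).2,
      (wz_wzb_conj (hp.differentiableAt (by simp))).2] at h3
    rw [wzb_congr e, h3, h2, h.maslovField_eq hz, ← h.wz_confFactor_conj hz] at h1
    have h4 := h.codazzi hz
    rw [hq] at h4
    -- Codazzi with q_z̄ = 0 says ∂_z(p/E²) = 0; its conjugate is ∂̄X = 0.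
    have h5 : wz (meanCoeff G) z = 2 * meanCoeff G z * wz (confFactor G) z / confFactor G z := by
      linear_combination -h4
    have h6 := congrArg conj h5
    simp only [map_div₀, map_mul, map_ofNat, confFactor_conj] at h6
    rw [h6] at h1
    have h7 : confFactor G z * confFactor G z * wzb (maslovField G) z = 0 := by
      have e8 : confFactor G z * confFactor G z * wzb (maslovField G) z =
        -Complex.I * (2 * conj (meanCoeff G z) * conj (wz (confFactor G) z) / confFactor G z) -
          2 * confFactor G z * conj (wz (confFactor G) z) *
            (-Complex.I * conj (meanCoeff G z) / confFactor G z ^ 2) := by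
        linear_combination -h1
      rw [e8]
      field_simp
      ring
    simpa [hne] using h7
  have hE' := h.expU_ne hz
  rw [h.expU_eq hz] at hE'
  set D : ℂ →L[ℝ] ℝ := fderiv ℝ (fun w => (confFactor G w).re) z with hD
  -- In the Lie derivative of 2E Re(v w̄), differentiating E contributes dE(X)/E, and multiplication
  -- by X' in the two slots contributes 2 Re X'.
  refine ⟨D (maslovField G z) / (confFactor G z).re + 2 * (deriv (maslovField G) z).re,
    fun v w => ?_⟩
  have d1 : fderiv ℝ (fun y => pullMetric G y v w) z (maslovField G z) =
      D (maslovField G z) * (2 * (v * conj w).re) := by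
    have : (fun y => pullMetric G y v w) =ᶠ[𝓝 z]
        fun y => (confFactor G y).re * (2 * (v * conj w).re) :=
      h.eventually hz fun y hy => h.pullMetric_eq hy v w
    rw [this.fderiv_eq, fderiv_mul_const]
    · simp [hD, mul_comm]
    · exact (Complex.reCLM.differentiableAt).comp z (hE.differentiableAt (by simp))
  have d2 : ∀ u, fderiv ℝ (maslovField G) z u = deriv (maslovField G) z * u := fun u => by
    rw [hX.hasDerivAt.complexToReal_fderiv.fderiv]; simp
  rw [lieMetric, d1, d2, d2, h.pullMetric_eq hz, h.pullMetric_eq hz, h.pullMetric_eq hz]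
  have e1 : (deriv (maslovField G) z * v * conj w).re + (v * conj (deriv (maslovField G) z * w)).re =
      2 * (deriv (maslovField G) z).re * (v * conj w).re := by
    simp
    ring
  have : ((deriv (maslovField G) z * v * conj w).re) =
      2 * (deriv (maslovField G) z).re * (v * conj w).re -
        (v * conj (deriv (maslovField G) z * w)).re := by linarith
  rw [this]
  field_simp
  ring

end IsLagrangianFrame

/-! Invariance under a constant phase and under changes of coordinate. -/

theorem wz_wzb_const_smul {V : Type*} [NormedAddCommGroup V] [NormedSpace ℝ V] [NormedSpace ℂ V]
    [IsScalarTower ℝ ℂ V] (a : ℂ) {f : ℂ → V} {z : ℂ} (hf : DifferentiableAt ℝ f z) :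
    wz (fun w => a • f w) z = a • wz f z ∧ wzb (fun w => a • f w) z = a • wzb f z := by
  have := wz_wzb_smul (a := fun _ => a) (by fun_prop) hf
  rw [(IsLagrangianFrame.wz_wzb_const (f := fun _ => a) (z := z) (.of_forall fun _ => rfl)).1,
    (IsLagrangianFrame.wz_wzb_const (f := fun _ => a) (z := z) (.of_forall fun _ => rfl)).2] at this
  simpa using this

/-- A constant phase passes through all derivatives and is invisible to the Hermitian form. This
makes the cubic differential independent of the horizontal lift. -/
theorem cubicCoeff_phase {G G' : ℂ → Amb c} {z a : ℂ} (ha : ‖a‖ = 1) (hG : ContDiffAt ℝ ∞ G z)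
    (h : ∀ᶠ w in 𝓝 z, G' w = a • G w) :
    cubicCoeff G' z = cubicCoeff G z ∧ confFactor G' z = confFactor G z := by
  have hd : ∀ᶠ w in 𝓝 z, DifferentiableAt ℝ G w :=
    ((hG.of_le (m := 1) (by norm_cast)).eventually (by simp)).mono
      fun w hw => hw.differentiableAt (by simp)
  have h1 : ∀ᶠ w in 𝓝 z, wz G' w = a • wz G w := by
    filter_upwards [h.eventually_nhds, hd] with w hw hdw
    rw [wz_congr hw, (wz_wzb_const_smul a hdw).1]
  have h2 : wzb G' z = a • wzb G z := by
    rw [wzb_congr h, (wz_wzb_const_smul a hd.self_of_nhds).2]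
  have h3 : wz (wz G') z = a • wz (wz G) z := by
    rw [wz_congr h1, (wz_wzb_const_smul a (hG.wz.differentiableAt (by simp))).1]
  rw [cubicCoeff, cubicCoeff, confFactor, confFactor, h3, h2, h1.self_of_nhds, herm_smul_smul c a ha,
    herm_smul_smul c a ha]
  exact ⟨rfl, rfl⟩

/-- The second derivative along τ contributes (τ')², and the antiholomorphic derivative in the
conjugate linear slot another τ'. The term with τ'' is a multiple of G_z, orthogonal to G_z̄. -/
theorem IsLagrangianFrame.cubicCoeff_comp {G : ℂ → Amb c} {Ω : Set ℂ} {τ : ℂ → ℂ} {z : ℂ}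
    (h : IsLagrangianFrame G Ω) (hz : τ z ∈ Ω) (hτ : AnalyticAt ℂ τ z) :
    cubicCoeff (fun w => G (τ w)) z = deriv τ z ^ 3 * cubicCoeff G (τ z) := by
  have h1 : ∀ᶠ w in 𝓝 z, wz (fun w => G (τ w)) w = deriv τ w • wz G (τ w) := by
    filter_upwards [hτ.eventually_analyticAt, hτ.continuousAt.eventually (h.isOpen.mem_nhds hz)]
      with w hw hw'
    exact (wz_wzb_comp_holomorphic hw.differentiableAt (h.diff hw')).1
  have h2 := (wz_wzb_comp_holomorphic hτ.differentiableAt (h.diff hz)).2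
  have hcomp : DifferentiableAt ℝ (fun w => wz G (τ w)) z :=
    DifferentiableAt.comp (g := wz G) z (h.diff_wz hz)
      (hτ.differentiableAt.restrictScalars ℝ)
  rw [cubicCoeff, wz_congr h1, h2,
    (wz_wzb_smul (hτ.deriv.differentiableAt.restrictScalars ℝ) hcomp).1,
    (wz_wzb_comp_holomorphic hτ.differentiableAt (h.diff_wz hz)).1, cubicCoeff]
  simp only [herm_add_left, herm_smul_left, herm_smul_right, h.ortho _ hz, Complex.conj_conj]
  ring

/-! ### Rigidity -/

theorem wz_wzb_herm_const (X : Amb c) {B : ℂ → Amb c} {z : ℂ} (hB : DifferentiableAt ℝ B z) :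
    wz (fun w => herm c X (B w)) z = herm c X (wzb B z) ∧
      wzb (fun w => herm c X (B w)) z = herm c X (wz B z) := by
  refine wz_eq_of_fderiv fun v => ?_
  rw [fderiv_herm (by fun_prop) hB, fderiv_eq_wz B]
  simp [herm_zero_left, herm_add_right, herm_smul_right]
  ring

theorem diff_herm_const (X : Amb c) {B : ℂ → Amb c} {z : ℂ} (hB : DifferentiableAt ℝ B z) :
    DifferentiableAt ℝ (fun w => herm c X (B w)) z :=
  (hermL c X).differentiableAt.comp z hB

theorem wz_wzb_inv {e : ℂ → ℂ} {z : ℂ} (he : DifferentiableAt ℝ e z) (hne : e z ≠ 0) :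
    DifferentiableAt ℝ (fun w => (e w)⁻¹) z ∧
    wz (fun w => (e w)⁻¹) z = -wz e z * (e z)⁻¹ ^ 2 ∧
      wzb (fun w => (e w)⁻¹) z = -wzb e z * (e z)⁻¹ ^ 2 := by
  have hi : DifferentiableAt ℝ (fun w => (e w)⁻¹) z := he.inv hne
  have h1 := wz_wzb_smul he hi
  have h2 : ∀ᶠ w in 𝓝 z, e w • (e w)⁻¹ = 1 := by
    filter_upwards [he.continuousAt.eventually_ne hne] with w hw
    simp [hw]
  rw [(IsLagrangianFrame.wz_wzb_const h2).1, (IsLagrangianFrame.wz_wzb_const h2).2] at h1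
  obtain ⟨h3, h4⟩ := h1
  simp only [smul_eq_mul] at h3 h4
  refine ⟨hi, ?_, ?_⟩ <;> field_simp at h3 h4 ⊢
  · linear_combination -h3
  · linear_combination -h4

/-- The linear map taking the frame of `G₁` at `z` to the one of `G₂`. -/
def frameMap (G₁ G₂ : ℂ → Amb c) (z : ℂ) : Amb c →ₗ[ℂ] Amb c where
  toFun X := (cval c * herm c X (G₁ z)) • G₂ z + (confFactor G₁ z)⁻¹ •
    (herm c X (wz G₁ z) • wz G₂ z + herm c X (wzb G₁ z) • wzb G₂ z)
  map_add' X Y := by simp only [herm_add_left]; module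
  map_smul' a X := by simp only [herm_smul_left, RingHom.id_apply]; module

theorem frameMap_apply (G₁ G₂ : ℂ → Amb c) (z : ℂ) (X : Amb c) :
    frameMap G₁ G₂ z X = (cval c * herm c X (G₁ z)) • G₂ z + (confFactor G₁ z)⁻¹ •
      (herm c X (wz G₁ z) • wz G₂ z + herm c X (wzb G₁ z) • wzb G₂ z) := rfl

section Frames

variable {G₁ G₂ : ℂ → Amb c} {Ω : Set ℂ} {z : ℂ}

/-- The structure equations have coefficients built from E, p, q and the derivatives of E, so both
frames satisfy the same linear system and the map carrying one to the other is constant. -/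
theorem wz_wzb_frameMap (h₁ : IsLagrangianFrame G₁ Ω) (h₂ : IsLagrangianFrame G₂ Ω) (hz : z ∈ Ω)
    (he : Set.EqOn (confFactor G₁) (confFactor G₂) Ω) (hp : meanCoeff G₁ z = meanCoeff G₂ z)
    (hq : cubicCoeff G₁ z = cubicCoeff G₂ z) (X : Amb c) :
    DifferentiableAt ℝ (fun w => frameMap G₁ G₂ w X) z ∧
    wz (fun w => frameMap G₁ G₂ w X) z = 0 ∧ wzb (fun w => frameMap G₁ G₂ w X) z = 0 := by
  have hne := h₁.ne z hz
  have da := diff_herm_const X (h₁.diff hz)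
  have db := diff_herm_const X (h₁.diff_wz hz)
  have dd := diff_herm_const X (h₁.diff_wzb hz)
  have dca : DifferentiableAt ℝ (fun w => cval c • herm c X (G₁ w)) z := da.const_smul (cval c)
  obtain ⟨du, u1, u2⟩ := wz_wzb_inv ((h₁.smooth_confFactor hz).differentiableAt (by simp)) hne
  have t1 := wz_wzb_smul dca (h₂.diff hz)
  have t2 := wz_wzb_smul db (h₂.diff_wz hz)
  have t3 := wz_wzb_smul dd (h₂.diff_wzb hz)
  have d1 : DifferentiableAt ℝ (fun w => (cval c • herm c X (G₁ w)) • G₂ w) z :=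
    dca.smul (h₂.diff hz)
  have d2 : DifferentiableAt ℝ (fun w => herm c X (wz G₁ w) • wz G₂ w) z := db.smul (h₂.diff_wz hz)
  have d3 : DifferentiableAt ℝ (fun w => herm c X (wzb G₁ w) • wzb G₂ w) z :=
    dd.smul (h₂.diff_wzb hz)
  have d23 : DifferentiableAt ℝ
    (fun w => herm c X (wz G₁ w) • wz G₂ w + herm c X (wzb G₁ w) • wzb G₂ w) z := d2.add d3
  have t23 := wz_wzb_add d2 d3
  have t4 := wz_wzb_smul du d23
  have d4 : DifferentiableAt ℝ (fun w => (confFactor G₁ w)⁻¹ •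
    (herm c X (wz G₁ w) • wz G₂ w + herm c X (wzb G₁ w) • wzb G₂ w)) z := du.smul d23
  have t5 := wz_wzb_add d1 d4
  have e12 : wz (confFactor G₂) z = wz (confFactor G₁) z :=
    wz_congr (h₁.eventually hz fun w hw => (he hw).symm)
  have f1 := h₁.frame_zz hz
  have f2 := h₁.frame_zzb hz
  have f3 := h₁.frame_zbzb hz
  have g1 := h₂.frame_zz hz
  have g2 := h₂.frame_zzb hz
  have g3 := h₂.frame_zbzb hz
  rw [← he hz, e12, ← hp, ← hq] at g1
  rw [← he hz, ← hp] at g2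
  rw [← he hz, e12, ← hp, ← hq] at g3
  have ce : conj (confFactor G₁ z) = confFactor G₁ z := confFactor_conj _ _
  refine ⟨d1.add d4, ?_, ?_⟩
  · refine t5.1.trans ?_
    rw [t1.1, t4.1, t23.1, t2.1, t3.1, u1, (wz_wzb_const_smul (cval c) da).1,
      (wz_wzb_herm_const X (h₁.diff hz)).1, (wz_wzb_herm_const X (h₁.diff_wz hz)).1,
      (wz_wzb_herm_const X (h₁.diff_wzb hz)).1, h₂.wz_wzb hz, f2, f3, g1, g2]
    simp only [herm_add_right, herm_smul_right, map_neg, map_mul, map_inv₀, ce, conj_cval,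
      Complex.conj_conj, smul_eq_mul]
    match_scalars <;> field_simp <;> ring
  · refine t5.2.trans ?_
    rw [t1.2, t4.2, t23.2, t2.2, t3.2, u2, (wz_wzb_const_smul (cval c) da).2,
      (wz_wzb_herm_const X (h₁.diff hz)).2, (wz_wzb_herm_const X (h₁.diff_wz hz)).2,
      (wz_wzb_herm_const X (h₁.diff_wzb hz)).2, h₁.wz_wzb hz, f1, f2, g2, g3,
      ← h₁.wz_confFactor_conj hz]
    simp only [herm_add_right, herm_smul_right, map_neg, map_mul, map_inv₀, ce, conj_cval,
      Complex.conj_conj, smul_eq_mul, map_sub, map_add]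
    match_scalars <;> field_simp <;> ring

theorem herm_frameMap (h₂ : IsLagrangianFrame G₂ Ω) (hz : z ∈ Ω)
    (he : confFactor G₁ z = confFactor G₂ z) (X : Amb c) :
    herm c (frameMap G₁ G₂ z X) (wz G₂ z) = herm c X (wz G₁ z) ∧
    herm c (frameMap G₁ G₂ z X) (wzb G₂ z) = herm c X (wzb G₁ z) ∧
    (c ≠ 0 → herm c (frameMap G₁ G₂ z X) (G₂ z) = herm c X (G₁ z)) := by
  have e1 : herm c (wz G₂ z) (wz G₂ z) = confFactor G₂ z := rfl
  have e2 := h₂.eq z hz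
  have hne := h₂.ne z hz
  have o5 := h₂.ortho z hz
  have o6 := h₂.ortho' hz
  have m1 : cval c * herm c (G₂ z) (wz G₂ z) = cval c * 0 := IsLagrangianFrame.cval_mul_eq fun hc => by
    rw [← herm_conj, h₂.hor_wz hc z hz, map_zero]
  have m2 : cval c * herm c (G₂ z) (wzb G₂ z) = cval c * 0 := IsLagrangianFrame.cval_mul_eq fun hc => by
    rw [← herm_conj, h₂.hor_wzb hc z hz, map_zero]
  simp only [frameMap_apply, herm_add_left, herm_smul_left, he]
  refine ⟨?_, ?_, fun hc => ?_⟩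
  · rw [o6, e1]
    field_simp
    linear_combination confFactor G₂ z * herm c X (G₁ z) * m1
  · rw [o5, e2]
    field_simp
    linear_combination confFactor G₂ z * herm c X (G₁ z) * m2
  · rw [h₂.hor_wz hc z hz, h₂.hor_wzb hc z hz, h₂.norm hc z hz]
    linear_combination herm c X (G₁ z) * cval_sq hc

/-- X and its image have the same components in frames with the same Gram matrix, so Parseval gives
equal products. -/
theorem frameMap_isometry (h₁ : IsLagrangianFrame G₁ Ω) (h₂ : IsLagrangianFrame G₂ Ω) (hz : z ∈ Ω)
    (he : confFactor G₁ z = confFactor G₂ z) (X Y : Amb c) :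
    herm c (frameMap G₁ G₂ z X) (frameMap G₁ G₂ z Y) = herm c X Y := by
  obtain ⟨x1, x2, x3⟩ := herm_frameMap h₂ hz he X
  obtain ⟨y1, y2, y3⟩ := herm_frameMap h₂ hz he Y
  rw [h₂.parseval hz, h₁.parseval hz X Y, x1, x2, y1, y2, he, mul_assoc (cval c),
    mul_assoc (cval c)]
  congr 1
  exact IsLagrangianFrame.cval_mul_eq fun hc => by rw [x3 hc, y3 hc]

theorem frameMap_wz (h₁ : IsLagrangianFrame G₁ Ω) (hz : z ∈ Ω) :
    frameMap G₁ G₂ z (wz G₁ z) = wz G₂ z ∧ frameMap G₁ G₂ z (wzb G₁ z) = wzb G₂ z := by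
  have e1 : herm c (wz G₁ z) (wz G₁ z) = confFactor G₁ z := rfl
  have hne := h₁.ne z hz
  rw [frameMap_apply, frameMap_apply, IsLagrangianFrame.cval_mul_eq (h₁.hor_wz · z hz),
    IsLagrangianFrame.cval_mul_eq (h₁.hor_wzb · z hz), e1, h₁.eq z hz, h₁.ortho z hz, h₁.ortho' hz]
  constructor <;> match_scalars <;> field_simp <;> ring

/-- Two frames with the same metric, mean curvature form and cubic differential differ by a rigid
motion. -/
theorem exists_rigidMotion (h₁ : IsLagrangianFrame G₁ Ω) (h₂ : IsLagrangianFrame G₂ Ω)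
    (hΩ : IsPreconnected Ω) (hne : Ω.Nonempty)
    (he : Set.EqOn (confFactor G₁) (confFactor G₂) Ω)
    (hp : Set.EqOn (meanCoeff G₁) (meanCoeff G₂) Ω)
    (hq : Set.EqOn (cubicCoeff G₁) (cubicCoeff G₂) Ω) :
    ∃ T : RigidMotion c, ∀ z ∈ Ω, G₂ z = T.A (G₁ z) + T.b := by
  obtain ⟨z₀, hz₀⟩ := hne
  have hconst : ∀ X, ∀ z ∈ Ω, frameMap G₁ G₂ z X = frameMap G₁ G₂ z₀ X := by
    intro X z hz
    refine h₁.isOpen.is_const_of_fderiv_eq_zero (𝕜 := ℝ) (f := fun w => frameMap G₁ G₂ w X) hΩ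
      (fun w hw => (wz_wzb_frameMap h₁ h₂ hw he (hp hw) (hq hw) X).1.differentiableWithinAt)
      (fun w hw => ?_) hz hz₀
    ext1 v
    obtain ⟨_, e1, e2⟩ := wz_wzb_frameMap h₁ h₂ hw he (hp hw) (hq hw) X
    rw [fderiv_eq_wz, e1, e2]
    simp
  have hinj : Function.Injective (frameMap G₁ G₂ z₀) := by
    rw [← LinearMap.ker_eq_bot, LinearMap.ker_eq_bot']
    intro X hX
    refine eq_zero_of_herm_eq_zero fun Y => ?_
    rw [← frameMap_isometry h₁ h₂ hz₀ (he hz₀), hX, herm_zero_left]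
  let A : Amb c ≃ₗ[ℂ] Amb c := LinearEquiv.ofInjectiveEndo _ hinj
  have hA : ∀ X, A X = frameMap G₁ G₂ z₀ X := fun X => rfl
  -- For c ≠ 0 the position vector belongs to the frame, so A takes G₁ to G₂ at z₀ and the
  -- translation vanishes. In general G₂ - A G₁ has zero differential, since A matches the first
  -- derivatives throughout Ω.
  refine ⟨⟨A, G₂ z₀ - A (G₁ z₀), fun Z W => ?_, fun hc => ?_⟩, fun z hz => ?_⟩
  · rw [hA, hA, frameMap_isometry h₁ h₂ hz₀ (he hz₀)]
  · rw [hA, frameMap_apply, h₁.norm hc z₀ hz₀, cval_sq hc, ← herm_conj (wz G₁ z₀),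
      ← herm_conj (wzb G₁ z₀), h₁.hor_wz hc z₀ hz₀, h₁.hor_wzb hc z₀ hz₀]
    simp
  · let L : Amb c →L[ℝ] Amb c := (A.toLinearMap.restrictScalars ℝ).toContinuousLinearMap
    have hL : ∀ X, L X = A X := fun X => rfl
    have hd : ∀ w ∈ Ω, HasFDerivAt (fun w => G₂ w - L (G₁ w))
        (fderiv ℝ G₂ w - L.comp (fderiv ℝ G₁ w)) w := fun w hw =>
      (h₂.diff hw).hasFDerivAt.sub (L.hasFDerivAt.comp w (h₁.diff hw).hasFDerivAt)
    have := h₁.isOpen.is_const_of_fderiv_eq_zero (𝕜 := ℝ) (f := fun w => G₂ w - L (G₁ w)) hΩ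
      (fun w hw => (hd w hw).differentiableAt.differentiableWithinAt)
      (fun w hw => ?_) hz hz₀
    · simp only [hL] at this
      change G₂ z = A (G₁ z) + (G₂ z₀ - A (G₁ z₀))
      rw [← this]; abel
    · rw [(hd w hw).fderiv]
      ext1 v
      obtain ⟨e1, e2⟩ := frameMap_wz (G₂ := G₂) h₁ hw
      rw [hconst _ w hw, ← hA] at e1 e2
      simp only [sub_apply, ContinuousLinearMap.comp_apply, hL]
      rw [fderiv_eq_wz, fderiv_eq_wz, map_add, map_smul, map_smul, e1, e2, sub_self]
      rfl

theorem hopf_eq_iff {Z W : totalSpace c} : hopf Z = hopf W ↔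
    ∃ a : ℂ, ‖a‖ = 1 ∧ (c = 0 → a = 1) ∧ (W : Amb c) = a • (Z : Amb c) :=
  Quotient.eq (r := phaseSetoid c)

theorem fderiv_rigid (T : RigidMotion c) {G : ℂ → Amb c} (hG : DifferentiableAt ℝ G z) :
    DifferentiableAt ℝ (fun w => T.A (G w)) z ∧
    wz (fun w => T.A (G w)) z = T.A (wz G z) ∧ wzb (fun w => T.A (G w)) z = T.A (wzb G z) := by
  let L : Amb c →L[ℝ] Amb c := (T.A.toLinearMap.restrictScalars ℝ).toContinuousLinearMap
  have hL : ∀ X, L X = T.A X := fun X => rfl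
  have hd : HasFDerivAt (fun w => T.A (G w)) (L.comp (fderiv ℝ G z)) z :=
    L.hasFDerivAt.comp z hG.hasFDerivAt
  refine ⟨hd.differentiableAt, wz_eq_of_fderiv fun v => ?_⟩
  rw [hd.fderiv, ContinuousLinearMap.comp_apply, hL, fderiv_eq_wz, map_add, map_smul, map_smul]

/-- A rigid motion is determined by its restriction to a piece of Lagrangian surface. -/
theorem rigidMotion_act_eq {G : ℂ → Amb c} (h : IsLagrangianFrame G Ω) (hz : z ∈ Ω)
    (T T' : RigidMotion c)
    (heq : ∀ w ∈ Ω, ∃ a : ℂ, ‖a‖ = 1 ∧ (c = 0 → a = 1) ∧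
      T'.A (G w) + T'.b = a • (T.A (G w) + T.b)) :
    T.act = T'.act := by
  choose! a ha1 ha0 haeq using heq
  have dT := fun w hw => fderiv_rigid T (h.diff (z := w) hw)
  have dT' := fun w hw => fderiv_rigid T' (h.diff (z := w) hw)
  by_cases hc : c = 0
  · have hb : ∀ w ∈ Ω, T'.A (G w) = T.A (G w) + (T.b - T'.b) := fun w hw => by
      have := haeq w hw
      rw [ha0 w hw hc, one_smul] at this
      rw [eq_sub_of_add_eq this]; abel
    have hb' := h.eventually hz hb
    have k0 : wz (fun _ : ℂ => T.b - T'.b) z = 0 ∧ wzb (fun _ : ℂ => T.b - T'.b) z = 0 :=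
      wz_eq_of_fderiv fun v => by simp
    have d := wz_wzb_add (dT z hz).1 (g := fun _ => T.b - T'.b) (by fun_prop)
    rw [← wz_congr hb', ← wzb_congr hb', (dT' z hz).2.1, (dT' z hz).2.2, (dT z hz).2.1,
      (dT z hz).2.2, k0.1, k0.2, add_zero, add_zero] at d
    have hA : ∀ X, T'.A X = T.A X := by
      intro X
      have hX := h.expansion hz X
      subst hc
      rw [cval_zero, zero_mul, zero_smul, zero_add] at hX
      rw [hX]
      simp only [map_smul, map_add, d.1, d.2]
    have hbb : T.b = T'.b := by
      have := hb z hz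
      rw [hA, left_eq_add, sub_eq_zero] at this
      exact this
    funext x
    induction x using Quotient.inductionOn with
    | h Z =>
      change hopf (T.onTotal Z) = hopf (T'.onTotal Z)
      congr 1
      apply Subtype.ext
      change T.A Z + T.b = T'.A Z + T'.b
      rw [hA, hbb]
  · have hb : ∀ w ∈ Ω, T'.A (G w) = a w • T.A (G w) := fun w hw => by
      have := haeq w hw
      rwa [T.translation hc, T'.translation hc, add_zero, add_zero] at this
    -- The phase was merely chosen pointwise; this formula makes it differentiable.
    have hav : ∀ w ∈ Ω, a w = cval c • herm c (T'.A (G w)) (T.A (G w)) := fun w hw => by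
      rw [hb w hw, herm_smul_left, T.isometry, h.norm hc w hw, smul_eq_mul]
      linear_combination -a w * cval_sq hc
    have haz : a z ≠ 0 := fun h0 => by simpa [h0] using ha1 z hz
    have hda : DifferentiableAt ℝ a z := by
      refine DifferentiableAt.congr_of_eventuallyEq ?_ (h.eventually hz hav)
      refine DifferentiableAt.const_smul ?_ (cval c)
      exact ((hermL c).differentiableAt.comp z (dT' z hz).1).clm_apply (dT z hz).1
    have d := wz_wzb_smul hda (dT z hz).1
    have hb' := h.eventually hz hb
    rw [← wz_congr hb', ← wzb_congr hb', (dT' z hz).2.1, (dT' z hz).2.2, (dT z hz).2.1,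
      (dT z hz).2.2] at d
    -- Differentiating A'G = a·AG leaves an unwanted multiple s of AG. As A'X remains orthogonal to
    -- A'G = a·AG when X is horizontal, s = 0.
    have key : ∀ {X : Amb c} {s : ℂ}, herm c X (G z) = 0 →
        T'.A X = s • T.A (G z) + a z • T.A X → T'.A X = a z • T.A X := by
      intro X s hX hs
      have e1 : herm c (T'.A X) (T'.A (G z)) = 0 := by rw [T'.isometry, hX]
      rw [hs, hb z hz, herm_smul_right, herm_add_left, herm_smul_left, herm_smul_left, T.isometry,
        T.isometry, hX, h.norm hc z hz] at e1
      have hca : conj (a z) ≠ 0 := by simpa using haz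
      have : s = 0 := by simpa [hca, cval_ne_zero hc] using e1
      rw [hs, this, zero_smul, zero_add]
    have k1 := key (h.hor_wz hc z hz) d.1
    have k2 := key (h.hor_wzb hc z hz) d.2
    have hA : ∀ X, T'.A X = a z • T.A X := by
      intro X
      rw [h.expansion hz X]
      simp only [map_smul, map_add, k1, k2, hb z hz]
      module
    funext x
    induction x using Quotient.inductionOn with
    | h Z =>
      change hopf (T.onTotal Z) = hopf (T'.onTotal Z)
      rw [hopf_eq_iff]
      refine ⟨a z, ha1 z hz, fun h => absurd h hc, ?_⟩
      change T'.A Z + T'.b = a z • (T.A Z + T.b)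
      rw [T.translation hc, T'.translation hc, add_zero, add_zero, hA]

end Frames

/-! ### Lifts in coordinates -/

section Surface

variable {S : Type*} [TopologicalSpace S] {c : SignType}

/-- Near a point, the expressions of a map in two coordinates differ by the transition map. -/
theorem eventually_transition {α : Type*} (F : S → α) {e e' : OpenPartialHomeomorph S ℂ} {p : S}
    (hp : p ∈ e.source) (hp' : p ∈ e'.source) :
    F ∘ e.symm =ᶠ[𝓝 (e p)] fun w => (F ∘ e'.symm) ((e' ∘ e.symm) w) := by
  have hs : ∀ᶠ w in 𝓝 (e p), e.symm w ∈ e'.source := by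
    refine (e.continuousAt_symm (e.map_source hp)).eventually (e'.open_source.mem_nhds ?_)
    simpa [hp] using hp'
  filter_upwards [hs] with w hw
  simp [hw]

/-- The part of the range of a coordinate over an open set. -/
def chartDomain (e : OpenPartialHomeomorph S ℂ) (U : Set S) : Set ℂ := e.target ∩ e.symm ⁻¹' U

theorem isOpen_chartDomain (e : OpenPartialHomeomorph S ℂ) {U : Set S} (hU : IsOpen U) :
    IsOpen (chartDomain e U) :=
  e.isOpen_inter_preimage_symm hU

theorem mem_chartDomain {e : OpenPartialHomeomorph S ℂ} {U : Set S} {p : S} (hp : p ∈ U ∩ e.source) :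
    e p ∈ chartDomain e U :=
  ⟨e.map_source hp.2, by simpa [hp.2] using hp.1⟩

theorem exists_of_mem_chartDomain {e : OpenPartialHomeomorph S ℂ} {U : Set S} {w : ℂ}
    (hw : w ∈ chartDomain e U) : e.symm w ∈ U ∩ e.source ∧ e (e.symm w) = w :=
  ⟨⟨hw.2, e.map_target hw.1⟩, e.right_inv hw.1⟩

variable [ChartedSpace ℂ S]

theorem analyticAt_transition [IsManifold 𝓘(ℂ) ω S] {e e' : OpenPartialHomeomorph S ℂ}
    (he : e ∈ atlas ℂ S) (he' : e' ∈ atlas ℂ S) {p : S} (hp : p ∈ e.source) (hp' : p ∈ e'.source) :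
    AnalyticAt ℂ (e' ∘ e.symm) (e p) := by
  have h1 : e.symm ≫ₕ e' ∈ contDiffGroupoid ω 𝓘(ℂ) := HasGroupoid.compatible he he'
  have h2 := contMDiffOn_iff_contDiffOn.mp (contMDiffOn_of_mem_contDiffGroupoid h1)
  have h3 : e p ∈ (e.symm ≫ₕ e').source := by
    simp [hp, hp', e.map_source hp]
  exact (h2.contDiffAt ((e.symm ≫ₕ e').open_source.mem_nhds h3)).analyticAt

theorem deriv_transition_mul [IsManifold 𝓘(ℂ) ω S] {e e' : OpenPartialHomeomorph S ℂ}
    (he : e ∈ atlas ℂ S) (he' : e' ∈ atlas ℂ S) {p : S} (hp : p ∈ e.source) (hp' : p ∈ e'.source) :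
    deriv (e ∘ e'.symm) (e' p) * deriv (e' ∘ e.symm) (e p) = 1 := by
  have h1 := (analyticAt_transition he he' hp hp').differentiableAt.hasDerivAt
  have h2 := (analyticAt_transition he' he hp' hp).differentiableAt.hasDerivAt
  have e1 : (e' ∘ e.symm) (e p) = e' p := by simp [hp]
  rw [← e1] at h2
  have h3 := (h2.comp (e p) h1).deriv
  rw [e1] at h3
  have : (e ∘ e'.symm) ∘ (e' ∘ e.symm) =ᶠ[𝓝 (e p)] id := by
    have hs : ∀ᶠ w in 𝓝 (e p), w ∈ e.target ∧ e.symm w ∈ e'.source := by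
      refine (e.open_target.eventually_mem (e.map_source hp)).and ?_
      refine (e.continuousAt_symm (e.map_source hp)).eventually (e'.open_source.mem_nhds ?_)
      simpa [hp] using hp'
    filter_upwards [hs] with w hw
    simp [hw.1, hw.2]
  rw [this.deriv_eq] at h3
  simpa using h3.symm

theorem IsLocalLift.contDiffAt {f : S → SpaceForm c} {U : Set S} {F : S → Amb c}
    (h : IsLocalLift f U F) {e : OpenPartialHomeomorph S ℂ} (he : e ∈ atlas ℂ S) {w : ℂ}
    (hw : w ∈ chartDomain e U) : ContDiffAt ℝ ∞ (F ∘ e.symm) w :=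
  (h.smooth e he).contDiffAt ((isOpen_chartDomain e h.isOpen).mem_nhds hw)

theorem IsLocalLift.norm {f : S → SpaceForm c} {U : Set S} {F : S → Amb c}
    (h : IsLocalLift f U F) (hc : c ≠ 0) {p : S} (hp : p ∈ U) : herm c (F p) (F p) = cval c :=
  (h.lift p hp).1 hc

theorem IsHorizontalLift.herm_fderiv {f : S → SpaceForm c} {U : Set S} {F : S → Amb c}
    (h : IsHorizontalLift f U F) (hc : c ≠ 0) {e : OpenPartialHomeomorph S ℂ} (he : e ∈ atlas ℂ S)
    {w : ℂ} (hw : w ∈ chartDomain e U) (v : ℂ) :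
    herm c (fderiv ℝ (F ∘ e.symm) w v) ((F ∘ e.symm) w) = 0 := by
  have hd := (h.contDiffAt he hw).differentiableAt (by simp)
  have h1 := fderiv_herm hd hd v
  have h2 : (fun w => herm c ((F ∘ e.symm) w) ((F ∘ e.symm) w)) =ᶠ[𝓝 w] fun _ => cval c :=
    Filter.mem_of_superset ((isOpen_chartDomain e h.isOpen).mem_nhds hw)
      fun w hw => h.norm hc hw.2
  rw [h2.fderiv_eq, ← herm_conj (fderiv ℝ _ w v)] at h1
  obtain ⟨hp, hpw⟩ := exists_of_mem_chartDomain hw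
  have h3 := h.horizontal hc e he _ hp v
  rw [ip_I_right, hpw] at h3
  apply Complex.ext
  · have := congrArg Complex.re h1
    simp at this
    simp; linarith
  · exact h3

/-- Two horizontal lifts of the same map differ by a locally constant phase. -/
theorem IsHorizontalLift.eventually_phase {f : S → SpaceForm c} {U U' : Set S} {F F' : S → Amb c}
    (h : IsHorizontalLift f U F) (h' : IsHorizontalLift f U' F') {e : OpenPartialHomeomorph S ℂ}
    (he : e ∈ atlas ℂ S) {p : S} (hp : p ∈ U ∩ U' ∩ e.source) :
    ∃ a : ℂ, ‖a‖ = 1 ∧ ∀ᶠ w in 𝓝 (e p), (F' ∘ e.symm) w = a • (F ∘ e.symm) w := by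
  have hph : ∀ q ∈ U ∩ U', ∃ a : ℂ, ‖a‖ = 1 ∧ (c = 0 → a = 1) ∧ F' q = a • F q := by
    intro q hq
    obtain ⟨h1, h2⟩ := h.lift q hq.1
    obtain ⟨h3, h4⟩ := h'.lift q hq.2
    exact hopf_eq_iff.mp (h2.symm.trans h4)
  choose! a ha1 ha0 ha using hph
  have hO := isOpen_chartDomain e (h.isOpen.inter h'.isOpen)
  have hmem := mem_chartDomain (e := e) hp
  refine ⟨a p, ha1 p hp.1, ?_⟩
  obtain ⟨r, hr, hball⟩ := Metric.isOpen_iff.mp hO _ hmem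
  refine Filter.mem_of_superset (Metric.ball_mem_nhds _ hr) fun w hw => ?_
  by_cases hc : c = 0
  · have := ha (e.symm w) (hball hw).2
    rw [ha0 _ (hball hw).2 hc] at this
    rw [ha0 p hp.1 hc]
    exact this
  · have hA : ∀ q ∈ U ∩ U', cval c * a q = herm c (F' q) (F q) := by
      intro q hq
      rw [ha q hq, herm_smul_left, h.norm hc hq.1, mul_comm]
    have hd1 : ∀ w ∈ Metric.ball (e p) r, DifferentiableAt ℝ (F ∘ e.symm) w := fun w hw =>
      (h.contDiffAt he ⟨(hball hw).1, (hball hw).2.1⟩).differentiableAt (by simp)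
    have hd2 : ∀ w ∈ Metric.ball (e p) r, DifferentiableAt ℝ (F' ∘ e.symm) w := fun w hw =>
      (h'.contDiffAt he ⟨(hball hw).1, (hball hw).2.2⟩).differentiableAt (by simp)
    -- The phase is c (F', F). As F' is a multiple of F, horizontality of both lifts makes the two
    -- terms of d(F', F) vanish.
    have hconst := Metric.isOpen_ball.is_const_of_fderiv_eq_zero (𝕜 := ℝ)
      (f := fun w => herm c ((F' ∘ e.symm) w) ((F ∘ e.symm) w))
      (convex_ball (e p) r).isPreconnected
      (fun w hw => (((hermL c).differentiableAt.comp w (hd2 w hw)).clm_apply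
        (hd1 w hw)).differentiableWithinAt)
      (fun w hw => by
        ext1 v
        have k1 := h.herm_fderiv hc he (w := w) ⟨(hball hw).1, (hball hw).2.1⟩ v
        have k2 := h'.herm_fderiv hc he (w := w) ⟨(hball hw).1, (hball hw).2.2⟩ v
        have k3 : (F' ∘ e.symm) w = a (e.symm w) • (F ∘ e.symm) w := ha _ (hball hw).2
        have hane : conj (a (e.symm w)) ≠ 0 := by
          have := ha1 _ (hball hw).2
          intro h0
          rw [map_eq_zero] at h0
          simp [h0] at this
        rw [fderiv_herm (hd2 w hw) (hd1 w hw), k3, herm_smul_left, ← herm_conj _ ((F ∘ e.symm) w),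
          k1]
        rw [k3, herm_smul_right] at k2
        simpa [hane] using k2) hw (Metric.mem_ball_self hr)
    have e1 : (e.symm (e p)) = p := e.left_inv hp.2
    simp only [Function.comp_apply] at hconst
    rw [← hA _ (hball hw).2, e1, ← hA p hp.1] at hconst
    have := ha (e.symm w) (hball hw).2
    rw [mul_left_cancel₀ (cval_ne_zero hc) hconst] at this
    exact this

/-- The pulled back Kähler form vanishes: in terms of a lift that need not be horizontal. -/
theorem im_herm_fderiv_of_pullKahler {G : ℂ → Amb c} {Ω : Set ℂ} (hΩ : IsOpen Ω) (hc : c ≠ 0)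
    (hd : ∀ z ∈ Ω, DifferentiableAt ℝ G z) (hn : ∀ z ∈ Ω, herm c (G z) (G z) = cval c) {z : ℂ}
    (hz : z ∈ Ω) :
    (∀ v, (herm c (fderiv ℝ G z v) (G z)).re = 0) ∧
    ∀ v w, pullKahler G z v w = 0 → (herm c (fderiv ℝ G z v) (fderiv ℝ G z w)).im = 0 := by
  have hre : ∀ v, (herm c (fderiv ℝ G z v) (G z)).re = 0 := by
    intro v
    have h1 := fderiv_herm (hd z hz) (hd z hz) v
    have h2 : (fun w => herm c (G w) (G w)) =ᶠ[𝓝 z] fun _ => cval c :=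
      Filter.mem_of_superset (hΩ.mem_nhds hz) hn
    rw [h2.fderiv_eq, ← herm_conj (fderiv ℝ _ z v)] at h1
    have := congrArg Complex.re h1
    simp at this
    linarith
  refine ⟨hre, fun v w hk => ?_⟩
  rw [pullKahler, kahlerForm, ip, herm_smul_left] at hk
  simp only [hor, herm_sub_left, herm_sub_right, herm_smul_left, herm_smul_right, hn z hz, map_mul,
    conj_cval] at hk
  rw [← herm_conj (fderiv ℝ G z w) (G z)] at hk
  -- Both x and y are purely imaginary, so c·x·ȳ is real and projecting to the horizontal space does
  -- not change the imaginary part.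
  have r1 := hre v
  have r2 := hre w
  set x := herm c (fderiv ℝ G z v) (G z)
  set y := herm c (fderiv ℝ G z w) (G z)
  set H := herm c (fderiv ℝ G z v) (fderiv ℝ G z w)
  have ht : Complex.I * (H - cval c * conj y * x - cval c * x * (conj y - cval c * conj y * cval c)) =
      Complex.I * H - Complex.I * (cval c * conj y * x) := by
    linear_combination Complex.I * cval c * x * conj y * cval_sq hc
  have hk' : (Complex.I * H - Complex.I * (cval c * conj y * x)).re = 0 := by
    rw [← ht, ← hk]; congr 1; ring
  have hcv : (cval c).im = 0 := Complex.ofReal_im _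
  simpa [r1, r2, hcv] using hk'

theorem contDiffAt_of_hasFDerivAt {l : ℂ → ℝ} {w : ℂ → ℂ →L[ℝ] ℝ} {Ω : Set ℂ} (hΩ : IsOpen Ω)
    (hl : ∀ z ∈ Ω, HasFDerivAt l (w z) z) (hw : ∀ z ∈ Ω, ContDiffAt ℝ ∞ w z) {z : ℂ} (hz : z ∈ Ω) :
    ContDiffAt ℝ ∞ l z := by
  have : ContDiffOn ℝ ∞ l Ω := by
    rw [contDiffOn_infty_iff_fderiv_of_isOpen hΩ]
    refine ⟨fun x hx => (hl x hx).differentiableAt.differentiableWithinAt, ?_⟩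
    refine ContDiffOn.congr (fun x hx => (hw x hx).contDiffWithinAt) fun x hx => (hl x hx).fderiv
  exact this.contDiffAt (hΩ.mem_nhds hz)

/-- A Lagrangian map has horizontal lifts. -/
theorem exists_horizontalLift [IsManifold 𝓘(ℂ) ω S] {f : S → SpaceForm c}
    (hf : IsLagrangianImmersion f) (p : S) : ∃ U F, p ∈ U ∧ IsHorizontalLift f U F := by
  obtain ⟨U, F, hpU, hF⟩ := hf.smooth p
  by_cases hc : c = 0
  · exact ⟨U, F, hpU, hF, fun h => absurd hc h⟩
  set e := chartAt ℂ p
  have he : e ∈ atlas ℂ S := chart_mem_atlas ℂ p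
  have hpe : p ∈ e.source := mem_chart_source ℂ p
  obtain ⟨r, hr, hball⟩ := Metric.isOpen_iff.mp (isOpen_chartDomain e hF.isOpen) _
    (mem_chartDomain ⟨hpU, hpe⟩)
  set B := Metric.ball (e p) r
  have hBo : IsOpen B := Metric.isOpen_ball
  set G := F ∘ e.symm
  have hGs : ∀ z ∈ B, ContDiffAt ℝ ∞ G z := fun z hz => hF.contDiffAt he (hball hz)
  have hGd : ∀ z ∈ B, DifferentiableAt ℝ G z := fun z hz => (hGs z hz).differentiableAt (by simp)
  have hGn : ∀ z ∈ B, herm c (G z) (G z) = cval c := fun z hz => hF.norm hc (hball hz).2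
  -- This form of the Lagrangian condition is what makes the one-form `w` below closed.
  have hK : ∀ z ∈ B, ∀ v w, (herm c (fderiv ℝ G z v) (fderiv ℝ G z w)).im = 0 := by
    intro z hz v w
    refine (im_herm_fderiv_of_pullKahler hBo hc hGd hGn hz).2 v w ?_
    obtain ⟨h1, h2⟩ := exists_of_mem_chartDomain (hball hz)
    have := hf.lagrangian U F hF e he _ h1 v w
    rwa [h2] at this
  set cr : ℝ := ((c : ℤ) : ℝ)
  have hcr : cval c = cr := rfl
  have hcr2 : cr * cr = 1 := by
    have := cval_sq hc
    rw [hcr] at this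
    exact_mod_cast this
  -- For a real function l, Im(d(e^{il}G), e^{il}G) = Im(dG, G) + c dl. Horizontality thus asks for
  -- dl = -c Im(dG, G), as c² = 1.
  let w : ℂ → ℂ →L[ℝ] ℝ := fun z =>
    (-cr) • Complex.imCLM.comp (((hermL c).flip (G z)).comp (fderiv ℝ G z))
  have hwa : ∀ z v, w z v = -cr * (herm c (fderiv ℝ G z v) (G z)).im := fun z v => rfl
  have hws : ∀ z ∈ B, ContDiffAt ℝ ∞ w z := by
    intro z hz
    refine ContDiffAt.const_smul (-cr) ?_
    refine contDiffAt_const.clm_comp (ContDiffAt.clm_comp ?_ ?_)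
    · exact ((hermL c).flip.contDiff.contDiffAt).comp z (hGs z hz)
    · exact (hGs z hz).fderiv_right (m := ∞) (by norm_cast)
  have hsymm : ∀ z ∈ B, ∀ x y, fderiv ℝ w z x y = fderiv ℝ w z y x := by
    intro z hz
    have hwd := (hws z hz).differentiableAt (by simp)
    have hdd : DifferentiableAt ℝ (fderiv ℝ G) z :=
      ((hGs z hz).fderiv_right (m := 1) (by norm_cast)).differentiableAt (by simp)
    have key : ∀ x y, fderiv ℝ w z x y = -cr * (herm c (fderiv ℝ (fderiv ℝ G) z x y) (G z)).im := by
      intro x y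
      have k1 : fderiv ℝ (fun q => w q y) z x = fderiv ℝ w z x y := by
        rw [fderiv_clm_apply hwd (by fun_prop)]; simp
      have k2 : fderiv ℝ (fun q => fderiv ℝ G q y) z x = fderiv ℝ (fderiv ℝ G) z x y := by
        rw [fderiv_clm_apply hdd (by fun_prop)]; simp
      have k0 : DifferentiableAt ℝ (fun q => fderiv ℝ G q y) z := hdd.clm_apply (by fun_prop)
      have k3 : HasFDerivAt (fun q => w q y)
          ((-cr) • Complex.imCLM.comp (fderiv ℝ (fun q => herm c (fderiv ℝ G q y) (G q)) z)) z := by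
        have d0 : DifferentiableAt ℝ (fun q => herm c (fderiv ℝ G q y) (G q)) z :=
          ((hermL c).differentiableAt.comp z k0).clm_apply (hGd z hz)
        exact (Complex.imCLM.hasFDerivAt.comp z d0.hasFDerivAt).const_smul (-cr)
      rw [← k1, k3.fderiv]
      change -cr * (fderiv ℝ (fun q => herm c (fderiv ℝ G q y) (G q)) z x).im = _
      rw [fderiv_herm k0 (hGd z hz), k2, Complex.add_im, hK z hz, add_zero]
    intro x y
    rw [key, key, ((hGs z hz).isSymmSndFDerivAt (by simp; norm_cast)).eq]
  -- Poincaré lemma on the ball.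
  obtain ⟨l, hl⟩ := (convex_ball (e p) r).exists_forall_hasFDerivAt_of_fderiv_symmetric
    hBo (fun z hz => ((hws z hz).differentiableAt (by simp)).differentiableWithinAt)
    hsymm
  have hls : ∀ z ∈ B, ContDiffAt ℝ ∞ l z := fun z hz => contDiffAt_of_hasFDerivAt hBo hl hws hz
  let a : ℂ → ℂ := fun z => Complex.exp (Complex.I * (l z : ℂ))
  have ha1 : ∀ z, ‖a z‖ = 1 := fun z => by
    rw [show a z = Complex.exp ((l z : ℂ) * Complex.I) by simp [a, mul_comm]]
    exact Complex.norm_exp_ofReal_mul_I _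
  have has : ∀ z ∈ B, ContDiffAt ℝ ∞ a z := fun z hz =>
    (contDiffAt_const.mul ((Complex.ofRealCLM.contDiff.contDiffAt).comp z (hls z hz))).cexp
  have had : ∀ z ∈ B, ∀ v, fderiv ℝ a z v = a z * (Complex.I * (w z v : ℂ)) := by
    intro z hz v
    have h1 : HasFDerivAt (fun z => (l z : ℂ)) (Complex.ofRealCLM.comp (w z)) z :=
      Complex.ofRealCLM.hasFDerivAt.comp z (hl z hz)
    have h2 : HasFDerivAt a _ z := (h1.const_mul Complex.I).cexp
    rw [h2.fderiv]
    rfl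
  let K : ℂ → Amb c := fun z => a z • G z
  have hKs : ∀ z ∈ B, ContDiffAt ℝ ∞ K z := fun z hz => smul_contDiffAt (has z hz) (hGs z hz)
  have hKd : ∀ z ∈ B, DifferentiableAt ℝ K z := fun z hz => (hKs z hz).differentiableAt (by simp)
  have hKh : ∀ z ∈ B, ∀ v, ip c (fderiv ℝ K z v) (Complex.I • K z) = 0 := by
    intro z hz v
    have h1 : HasFDerivAt K _ z :=
      ((has z hz).differentiableAt (by simp)).hasFDerivAt.smul (hGd z hz).hasFDerivAt
    rw [ip_I_right, h1.fderiv]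
    change (herm c (a z • fderiv ℝ G z v + fderiv ℝ a z v • G z) (a z • G z)).im = 0
    have hre := (im_herm_fderiv_of_pullKahler hBo hc hGd hGn hz).1 v
    rw [had z hz, mul_smul, ← smul_add, herm_smul_smul c _ (ha1 z), herm_add_left, herm_smul_left,
      hGn z hz, hcr, hwa]
    simp
    linear_combination -(herm c (fderiv ℝ G z v) (G z)).im * hcr2
  have hU' : IsOpen (e.source ∩ e ⁻¹' B) := e.isOpen_inter_preimage hBo
  have hsub : ∀ q ∈ e.source ∩ e ⁻¹' B, q ∈ U := fun q hq => by
    have := (hball hq.2).2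
    simpa [hq.1] using this
  have hKe : ∀ q ∈ e.source ∩ e ⁻¹' B, K (e q) = a (e q) • F q := fun q hq => by
    simp [K, G, hq.1]
  refine ⟨e.source ∩ e ⁻¹' B, fun q => K (e q), ⟨hpe, Metric.mem_ball_self hr⟩, ⟨hU', ?_, ?_⟩, ?_⟩
  · intro e' he' x hx
    have hx' : e'.symm x ∈ e'.source := e'.map_target hx.1
    have hτ := analyticAt_transition he' he hx' hx.2.1
    rw [e'.right_inv hx.1] at hτ
    have : ContDiffAt ℝ ∞ (fun y => K ((e ∘ e'.symm) y)) x :=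
      ContDiffAt.comp (g := K) (f := e ∘ e'.symm) x (hKs _ hx.2.2)
        ((hτ.contDiffAt (n := ∞)).restrict_scalars ℝ)
    exact this.contDiffWithinAt
  · intro q hq
    obtain ⟨h1, h2⟩ := hF.lift q (hsub q hq)
    have h3 : K (e q) ∈ totalSpace c := fun hc => by
      rw [hKe q hq, herm_smul_smul c _ (ha1 _)]; exact h1 hc
    refine ⟨h3, h2.trans (hopf_eq_iff.mpr ⟨a (e q), ha1 _, fun h => absurd h hc, hKe q hq⟩)⟩
  · intro _ e' he' q hq v
    have hτ := (analyticAt_transition he' he hq.2 hq.1.1).differentiableAt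
    have e1 : (e ∘ e'.symm) (e' q) = e q := by simp [hq.2]
    have := fderiv_comp_holomorphic (f := K) hτ (by rw [e1]; exact hKd _ hq.1.2) v
    change ip c (fderiv ℝ (fun y => K ((e ∘ e'.symm) y)) (e' q) v) _ = 0
    rw [this, e1]
    exact hKh _ hq.1.2 _

end Surface

/-! ### The cubic differential of immersions sharing metric and mean curvature form -/

section Surface

variable {S : Type*} [TopologicalSpace S] [ChartedSpace ℂ S] {c : SignType}

/-- `f'` is a conformal Lagrangian immersion with the same conformal factor as `f` and with mean
curvature form `Φ`. -/
structure IsAdmissible (f : S → SpaceForm c) (Φ : ∀ p : S, TangentSpace 𝓘(ℂ) p →L[ℂ] ℂ)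
    (f' : S → SpaceForm c) : Prop where
  base : IsLagrangianImmersion f
  lagrangian : IsLagrangianImmersion f'
  meanCurvature : HasMeanCurvatureForm f' Φ
  conformal : ∀ U F, IsHorizontalLift f' U F → ∀ e ∈ atlas ℂ S, ∀ p ∈ U ∩ e.source,
    ∃ u : ℝ, ∀ v w : ℂ,
      pullMetric (F ∘ e.symm) (e p) v w = 2 * Real.exp u * (v * (starRingEnd ℂ) w).re
  metric : ∀ U F U' F', IsHorizontalLift f U F → IsHorizontalLift f' U' F' → ∀ e ∈ atlas ℂ S,
    ∀ p ∈ U ∩ U' ∩ e.source, expU (F ∘ e.symm) (e p) = expU (F' ∘ e.symm) (e p)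

theorem isLagrangianFrame_of_lift {f : S → SpaceForm c} (hf : IsLagrangianImmersion f) {U : Set S}
    {F : S → Amb c} (hF : IsHorizontalLift f U F) {e : OpenPartialHomeomorph S ℂ}
    (he : e ∈ atlas ℂ S)
    (hconf : ∀ p ∈ U ∩ e.source, ∃ u : ℝ, ∀ v w : ℂ,
      pullMetric (F ∘ e.symm) (e p) v w = 2 * Real.exp u * (v * (starRingEnd ℂ) w).re) :
    IsLagrangianFrame (F ∘ e.symm) (chartDomain e U) := by
  refine isLagrangianFrame_of_pull (isOpen_chartDomain e hF.isOpen)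
    (fun z hz => hF.contDiffAt he hz) (fun hc z hz => hF.norm hc hz.2) (fun hc z hz v => ?_)
    (fun z hz => ?_) (fun z hz v w => ?_)
  · rw [ip_I_right, hF.herm_fderiv hc he hz, Complex.zero_im]
  · obtain ⟨h1, h2⟩ := exists_of_mem_chartDomain hz
    have := hconf _ h1
    rwa [h2] at this
  · obtain ⟨h1, h2⟩ := exists_of_mem_chartDomain hz
    have := hf.lagrangian U F hF.toIsLocalLift e he _ h1 v w
    rwa [h2] at this

theorem IsAdmissible.frame {f f' : S → SpaceForm c} {Φ : ∀ p : S, TangentSpace 𝓘(ℂ) p →L[ℂ] ℂ}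
    (h : IsAdmissible f Φ f') {U : Set S} {F : S → Amb c} (hF : IsHorizontalLift f' U F)
    {e : OpenPartialHomeomorph S ℂ} (he : e ∈ atlas ℂ S) :
    IsLagrangianFrame (F ∘ e.symm) (chartDomain e U) :=
  isLagrangianFrame_of_lift h.lagrangian hF he (h.conformal U F hF e he)

theorem IsIsometricLagrangianWith.isAdmissible {f f' : S → SpaceForm c}
    {Φ : ∀ p : S, TangentSpace 𝓘(ℂ) p →L[ℂ] ℂ} (hf : IsLagrangianImmersion f)
    (hconf : IsConformal f) (h : IsIsometricLagrangianWith f Φ f') : IsAdmissible f Φ f' := by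
  refine ⟨hf, h.lagrangian, h.meanCurvature, fun U F hF e he p hp => ?_,
    fun U F U' F' hF hF' e he p hp => ?_⟩
  · obtain ⟨U₀, F₀, hp₀, hF₀⟩ := hf.smooth p
    obtain ⟨u, hu⟩ := hconf U₀ F₀ hF₀ e he p ⟨hp₀, hp.2⟩
    exact ⟨u, fun v w => by
      rw [← h.isometric U₀ F₀ hF₀ U F hF.toIsLocalLift e he p ⟨⟨hp₀, hp.1⟩, hp.2⟩, hu]⟩
  · have := h.isometric U F hF.toIsLocalLift U' F' hF'.toIsLocalLift e he p hp
    rw [expU, expU, this, this]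

theorem confFactor_eq_of_horizontalLift {f : S → SpaceForm c} {U U' : Set S} {F F' : S → Amb c}
    (h : IsHorizontalLift f U F) (h' : IsHorizontalLift f U' F') {e : OpenPartialHomeomorph S ℂ}
    (he : e ∈ atlas ℂ S) {p : S} (hp : p ∈ U ∩ U' ∩ e.source) :
    cubicCoeff (F' ∘ e.symm) (e p) = cubicCoeff (F ∘ e.symm) (e p) ∧
      confFactor (F' ∘ e.symm) (e p) = confFactor (F ∘ e.symm) (e p) := by
  obtain ⟨a, ha, hev⟩ := h.eventually_phase h' he hp
  exact cubicCoeff_phase ha (h.contDiffAt he (mem_chartDomain ⟨hp.1.1, hp.2⟩)) hev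

/-- Only horizontal lifts are compared, and two of them differ by a locally constant phase, which
preserves E. -/
theorem isAdmissible_self {f : S → SpaceForm c}
    {Φ : ∀ p : S, TangentSpace 𝓘(ℂ) p →L[ℂ] ℂ} (hf : IsLagrangianImmersion f)
    (hconf : IsConformal f) (hΦ : HasMeanCurvatureForm f Φ) : IsAdmissible f Φ f := by
  have hc : ∀ U F, IsHorizontalLift f U F → ∀ e ∈ atlas ℂ S, ∀ p ∈ U ∩ e.source,
      ∃ u : ℝ, ∀ v w : ℂ,
      pullMetric (F ∘ e.symm) (e p) v w = 2 * Real.exp u * (v * (starRingEnd ℂ) w).re :=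
    fun U F hF e he p hp => hconf U F hF.toIsLocalLift e he p hp
  refine ⟨hf, hf, hΦ, hc, fun U F U' F' hF hF' e he p hp => ?_⟩
  rw [(isLagrangianFrame_of_lift hf hF he (hc U F hF e he)).expU_eq (mem_chartDomain ⟨hp.1.1, hp.2⟩),
    (isLagrangianFrame_of_lift hf hF' he (hc U' F' hF' e he)).expU_eq
      (mem_chartDomain ⟨hp.1.2, hp.2⟩),
    (confFactor_eq_of_horizontalLift hF hF' he hp).2]

open Classical in
/-- The cubic differential of a Lagrangian immersion, in the coordinate `e`. -/
def cubicForm (f : S → SpaceForm c) (e : OpenPartialHomeomorph S ℂ) (w : ℂ) : ℂ :=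
  -- The chosen lift is immaterial by phase invariance (`cubicForm_eq`); the value 0 is a default,
  -- as a Lagrangian immersion has a horizontal lift near each point.
  if h : ∃ L : Set S × (S → Amb c), e.symm w ∈ L.1 ∧ IsHorizontalLift f L.1 L.2 then
    cubicCoeff (h.choose.2 ∘ e.symm) w else 0

theorem cubicForm_eq {f₁ : S → SpaceForm c} {U₁ : Set S} {F₁ : S → Amb c}
    {e : OpenPartialHomeomorph S ℂ} (hF₁ : IsHorizontalLift f₁ U₁ F₁) (he : e ∈ atlas ℂ S) {w : ℂ}
    (hw : w ∈ chartDomain e U₁) : cubicForm f₁ e w = cubicCoeff (F₁ ∘ e.symm) w := by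
  obtain ⟨⟨hp, hpe⟩, hpw⟩ := exists_of_mem_chartDomain hw
  have h : ∃ L : Set S × (S → Amb c), e.symm w ∈ L.1 ∧ IsHorizontalLift f₁ L.1 L.2 :=
    ⟨(U₁, F₁), hp, hF₁⟩
  rw [cubicForm, dif_pos h]
  have := (confFactor_eq_of_horizontalLift hF₁ h.choose_spec.2 he
    ⟨⟨hp, h.choose_spec.1⟩, hpe⟩).1
  rwa [hpw] at this

/-- Local rigidity integrates a vanishing differential, which requires a connected coordinate
domain. -/
theorem exists_chart_ball (p : S) {U : Set S} (hU : IsOpen U) (hp : p ∈ U) :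
    ∃ V : Set S, IsOpen V ∧ p ∈ V ∧ V ⊆ U ∧ V ⊆ (chartAt ℂ p).source ∧
      ∃ r > 0, chartDomain (chartAt ℂ p) V = Metric.ball (chartAt ℂ p p) r := by
  set e := chartAt ℂ p
  have hpe : p ∈ e.source := mem_chart_source ℂ p
  obtain ⟨r, hr, hball⟩ := Metric.isOpen_iff.mp (isOpen_chartDomain e hU) _
    (mem_chartDomain ⟨hp, hpe⟩)
  refine ⟨e.source ∩ e ⁻¹' Metric.ball (e p) r, e.isOpen_inter_preimage Metric.isOpen_ball,
    ⟨hpe, Metric.mem_ball_self hr⟩, fun q hq => ?_, fun q hq => hq.1, r, hr, ?_⟩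
  · have := (hball hq.2).2
    simpa [hq.1] using this
  · ext w
    constructor
    · intro hw
      have := hw.2.2
      simpa [hw.1] using this
    · intro hw
      have h1 := (hball hw).1
      exact ⟨h1, e.map_target h1, by simpa [h1] using hw⟩

variable [IsManifold 𝓘(ℂ) ω S]

/-! ### Comparison of two immersions -/

section TwoImmersions

variable {f f₁ f₂ : S → SpaceForm c} {Φ : ∀ p : S, TangentSpace 𝓘(ℂ) p →L[ℂ] ℂ}
  {U₁ U₂ : Set S} {F₁ F₂ : S → Amb c} {e : OpenPartialHomeomorph S ℂ}

theorem exists_mfderiv_ne_zero (he : e ∈ atlas ℂ S) {p : S} (hp : p ∈ e.source) :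
    ∃ v : TangentSpace 𝓘(ℂ) p, (show ℂ from mfderiv 𝓘(ℂ) 𝓘(ℂ) e p v) ≠ 0 := by
  have h1 : e.MDifferentiable 𝓘(ℂ) 𝓘(ℂ) := by
    have : IsManifold 𝓘(ℂ) 1 S := IsManifold.of_le (n := ω) le_top
    exact mdifferentiable_of_mem_atlas he
  obtain ⟨v, hv⟩ := (h1.mfderiv_bijective hp).2 (1 : ℂ)
  refine ⟨v, ?_⟩
  rw [hv]
  exact one_ne_zero

/-- Both conformal factors equal that of a horizontal lift of f. Evaluating Φ = φ dz where dz ≠ 0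
gives equal φ, hence equal p by `IsLagrangianFrame.phi_eq`. -/
theorem IsAdmissible.coeff_eq (h₁ : IsAdmissible f Φ f₁) (h₂ : IsAdmissible f Φ f₂)
    (hF₁ : IsHorizontalLift f₁ U₁ F₁) (hF₂ : IsHorizontalLift f₂ U₂ F₂) (he : e ∈ atlas ℂ S) {w : ℂ}
    (hw : w ∈ chartDomain e (U₁ ∩ U₂)) :
    confFactor (F₁ ∘ e.symm) w = confFactor (F₂ ∘ e.symm) w ∧
      meanCoeff (F₁ ∘ e.symm) w = meanCoeff (F₂ ∘ e.symm) w := by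
  obtain ⟨⟨hp, hpe⟩, hpw⟩ := exists_of_mem_chartDomain hw
  obtain ⟨U, F, hpU, hF⟩ := exists_horizontalLift h₁.base (e.symm w)
  have m1 := h₁.metric U F U₁ F₁ hF hF₁ e he _ ⟨⟨hpU, hp.1⟩, hpe⟩
  have m2 := h₂.metric U F U₂ F₂ hF hF₂ e he _ ⟨⟨hpU, hp.2⟩, hpe⟩
  have w1 : w ∈ chartDomain e U₁ := ⟨hw.1, hw.2.1⟩
  have w2 : w ∈ chartDomain e U₂ := ⟨hw.1, hw.2.2⟩
  have g1 := h₁.frame hF₁ he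
  have g2 := h₂.frame hF₂ he
  have hE : confFactor (F₁ ∘ e.symm) w = confFactor (F₂ ∘ e.symm) w := by
    rw [hpw] at m1 m2
    rw [← IsLagrangianFrame.confFactor_eq_re, ← IsLagrangianFrame.confFactor_eq_re (G := F₂ ∘ e.symm),
      ← g1.expU_eq w1, ← g2.expU_eq w2, ← m1, ← m2]
  refine ⟨hE, ?_⟩
  obtain ⟨v, hv⟩ := exists_mfderiv_ne_zero he hpe
  have p1 := h₁.meanCurvature U₁ F₁ hF₁ e he _ ⟨hp.1, hpe⟩ v
  have p2 := h₂.meanCurvature U₂ F₂ hF₂ e he _ ⟨hp.2, hpe⟩ v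
  have p3 := mul_right_cancel₀ hv (p1.symm.trans p2)
  rw [hpw, g1.phi_eq w1, g2.phi_eq w2, ← hE] at p3
  have hne := g1.ne w w1
  field_simp at p3
  exact neg_injective p3

/-- The cubic differentials of two isometric Lagrangian immersions with the same mean curvature form
have the same length, and their difference is holomorphic. -/
theorem IsAdmissible.cubicForm_compare (h₁ : IsAdmissible f Φ f₁) (h₂ : IsAdmissible f Φ f₂)
    (he : e ∈ atlas ℂ S) {w : ℂ} (hw : w ∈ e.target) :
    Complex.normSq (cubicForm f₁ e w) = Complex.normSq (cubicForm f₂ e w) ∧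
      DifferentiableAt ℂ (fun z => cubicForm f₁ e z - cubicForm f₂ e z) w := by
  obtain ⟨U₁, F₁, hp₁, hF₁⟩ := exists_horizontalLift h₁.lagrangian (e.symm w)
  obtain ⟨U₂, F₂, hp₂, hF₂⟩ := exists_horizontalLift h₂.lagrangian (e.symm w)
  have w1 : w ∈ chartDomain e U₁ := ⟨hw, hp₁⟩
  have w2 : w ∈ chartDomain e U₂ := ⟨hw, hp₂⟩
  have g1 := h₁.frame hF₁ he
  have g2 := h₂.frame hF₂ he
  have hO := (isOpen_chartDomain e (hF₁.isOpen.inter hF₂.isOpen)).mem_nhds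
    (show w ∈ chartDomain e (U₁ ∩ U₂) from ⟨hw, hp₁, hp₂⟩)
  have ev : ∀ᶠ z in 𝓝 w, confFactor (F₁ ∘ e.symm) z = confFactor (F₂ ∘ e.symm) z ∧
      meanCoeff (F₁ ∘ e.symm) z = meanCoeff (F₂ ∘ e.symm) z :=
    Filter.mem_of_superset hO fun z hz => h₁.coeff_eq h₂ hF₁ hF₂ he hz
  have evE := ev.mono fun z hz => hz.1
  have evp := ev.mono fun z hz => hz.2
  have evEz : ∀ᶠ z in 𝓝 w, wz (confFactor (F₁ ∘ e.symm)) z = wz (confFactor (F₂ ∘ e.symm)) z :=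
    evE.eventually_nhds.mono fun z hz => wz_congr hz
  have hE := evE.self_of_nhds
  have hp := evp.self_of_nhds
  have hEz := evEz.self_of_nhds
  constructor
  · rw [cubicForm_eq hF₁ he w1, cubicForm_eq hF₂ he w2]
    have k1 := g1.gauss w1
    have k2 := g2.gauss w2
    have k3 : wzb (fun z => wz (confFactor (F₁ ∘ e.symm)) z + meanCoeff (F₁ ∘ e.symm) z) w =
        wzb (fun z => wz (confFactor (F₂ ∘ e.symm)) z + meanCoeff (F₂ ∘ e.symm) z) w :=
      wzb_congr ((evEz.and evp).mono fun z hz => by simp only [hz.1, hz.2])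
    have k4 : wz (fun z => conj (meanCoeff (F₁ ∘ e.symm) z)) w =
        wz (fun z => conj (meanCoeff (F₂ ∘ e.symm) z)) w :=
      wz_congr (evp.mono fun z hz => by simp only [hz])
    rw [k3, k4, hE, hp, hEz, ← k2, Complex.mul_conj, Complex.mul_conj] at k1
    exact_mod_cast k1
  · have hev : (fun z => cubicForm f₁ e z - cubicForm f₂ e z) =ᶠ[𝓝 w]
        fun z => cubicCoeff (F₁ ∘ e.symm) z - cubicCoeff (F₂ ∘ e.symm) z :=
      Filter.mem_of_superset hO fun z hz => by
        simp only [Set.mem_ofPred_eq]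
        rw [cubicForm_eq hF₁ he ⟨hz.1, hz.2.1⟩, cubicForm_eq hF₂ he ⟨hz.1, hz.2.2⟩]
    refine DifferentiableAt.congr_of_eventuallyEq ?_ hev
    have d1 := g1.diff_cubicCoeff w1
    have d2 := g2.diff_cubicCoeff w2
    refine differentiableAt_of_wzb_eq_zero (d1.sub d2) ?_
    rw [(wz_wzb_sub d1 d2).2, g1.codazzi w1, g2.codazzi w2, hE, hp, hEz, wz_congr evp, sub_self]

theorem IsAdmissible.continuousAt_cubicForm (h₁ : IsAdmissible f Φ f₁) (he : e ∈ atlas ℂ S) {w : ℂ}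
    (hw : w ∈ e.target) : ContinuousAt (cubicForm f₁ e) w := by
  obtain ⟨U₁, F₁, hp₁, hF₁⟩ := exists_horizontalLift h₁.lagrangian (e.symm w)
  have hw₁ : w ∈ chartDomain e U₁ := ⟨hw, hp₁⟩
  have g := h₁.frame hF₁ he
  exact (g.diff_cubicCoeff hw₁).continuousAt.congr
    (g.eventually hw₁ fun z hz => (cubicForm_eq hF₁ he hz).symm)

theorem IsAdmissible.cubicForm_transition (h₁ : IsAdmissible f Φ f₁)
    {e e' : OpenPartialHomeomorph S ℂ} (he : e ∈ atlas ℂ S) (he' : e' ∈ atlas ℂ S) {p : S}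
    (hp : p ∈ e.source) (hp' : p ∈ e'.source) :
    cubicForm f₁ e (e p) = deriv (e' ∘ e.symm) (e p) ^ 3 * cubicForm f₁ e' (e' p) := by
  obtain ⟨U₁, F₁, hp₁, hF₁⟩ := exists_horizontalLift h₁.lagrangian p
  have w1 : e p ∈ chartDomain e U₁ := mem_chartDomain ⟨hp₁, hp⟩
  have w2 : e' p ∈ chartDomain e' U₁ := mem_chartDomain ⟨hp₁, hp'⟩
  have e1 : (e' ∘ e.symm) (e p) = e' p := by simp [hp]
  have hτ := analyticAt_transition he he' hp hp'
  have hev := eventually_transition F₁ hp hp'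
  have key := (h₁.frame hF₁ he').cubicCoeff_comp (by rwa [e1]) hτ
  have hs : ContDiffAt ℝ ∞ (fun w => (F₁ ∘ e'.symm) ((e' ∘ e.symm) w)) (e p) :=
    (hF₁.contDiffAt he w1).congr_of_eventuallyEq hev.symm
  have := (cubicCoeff_phase (G' := F₁ ∘ e.symm) (a := 1) (by simp) hs
    (hev.mono fun w hw => hw.trans (one_smul ℂ _).symm)).1
  rw [cubicForm_eq hF₁ he w1, cubicForm_eq hF₁ he' w2, this, key, e1]

/-- The Maslov form is conformal as soon as the cubic differential of one isometric Lagrangian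
immersion with the same mean curvature form is holomorphic. -/
theorem IsAdmissible.hasConformalMaslovForm (h : IsAdmissible f Φ f) (h₁ : IsAdmissible f Φ f₁)
    (hol : ∀ e ∈ atlas ℂ S, ∀ w ∈ e.target, DifferentiableAt ℂ (cubicForm f₁ e) w) :
    HasConformalMaslovForm f := by
  intro U F hF e he p hp
  have hw := mem_chartDomain hp
  have g := h.frame hF he
  refine g.conformal_of_holomorphic hw ?_
  -- Q_f = Q₁ + (Q_f - Q₁), and the difference is always holomorphic.
  have h2 : DifferentiableAt ℂ (cubicForm f e) (e p) := by
    have := (hol e he _ hw.1).add (h.cubicForm_compare h₁ he hw.1).2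
    refine this.congr_of_eventuallyEq (.of_forall fun z => ?_)
    simp
  rw [wzb_congr (g := cubicForm f e), (wzb_eq_zero_of_differentiableAt h2).2]
  exact g.eventually hw fun z hz => (cubicForm_eq hF he hz).symm

/-- Existence of a local motion alone does not globalize; its uniqueness on any smaller open set
allows the local motions to be matched. -/
theorem IsAdmissible.local_congruent (h₁ : IsAdmissible f Φ f₁) (h₂ : IsAdmissible f Φ f₂)
    (hq : ∀ e ∈ atlas ℂ S, Set.EqOn (cubicForm f₁ e) (cubicForm f₂ e) e.target) (p : S) :
    ∃ V : Set S, IsOpen V ∧ p ∈ V ∧ (∃ T : RigidMotion c, ∀ q ∈ V, f₂ q = T.act (f₁ q)) ∧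
      ∀ T T' : RigidMotion c, ∀ W : Set S, IsOpen W → W ⊆ V → W.Nonempty →
        (∀ q ∈ W, T.act (f₁ q) = T'.act (f₁ q)) → T.act = T'.act := by
  obtain ⟨U₁, F₁, hp₁, hF₁⟩ := exists_horizontalLift h₁.lagrangian p
  obtain ⟨U₂, F₂, hp₂, hF₂⟩ := exists_horizontalLift h₂.lagrangian p
  obtain ⟨V, hV, hpV, hVU, hVe, r, hr, hVr⟩ :=
    exists_chart_ball p (hF₁.isOpen.inter hF₂.isOpen) ⟨hp₁, hp₂⟩
  set e := chartAt ℂ p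
  have he : e ∈ atlas ℂ S := chart_mem_atlas ℂ p
  have hpe : p ∈ e.source := mem_chart_source ℂ p
  have hO := isOpen_chartDomain e hV
  have hsub : chartDomain e V ⊆ chartDomain e (U₁ ∩ U₂) := fun w hw => ⟨hw.1, hVU hw.2⟩
  have g1 := (h₁.frame hF₁ he).mono hO fun w hw => ⟨hw.1, (hVU hw.2).1⟩
  have g2 := (h₂.frame hF₂ he).mono hO fun w hw => ⟨hw.1, (hVU hw.2).2⟩
  refine ⟨V, hV, hpV, ?_, ?_⟩
  · obtain ⟨T, hT⟩ := exists_rigidMotion g1 g2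
      (by rw [hVr]; exact (convex_ball _ _).isPreconnected) ⟨e p, mem_chartDomain ⟨hpV, hpe⟩⟩
      (fun w hw => (h₁.coeff_eq h₂ hF₁ hF₂ he (hsub hw)).1)
      (fun w hw => (h₁.coeff_eq h₂ hF₁ hF₂ he (hsub hw)).2)
      (fun w hw => by
        rw [← cubicForm_eq hF₁ he ⟨hw.1, (hVU hw.2).1⟩, ← cubicForm_eq hF₂ he ⟨hw.1, (hVU hw.2).2⟩]
        exact hq e he hw.1)
    refine ⟨T, fun q hqV => ?_⟩
    obtain ⟨k1, l1⟩ := hF₁.lift q (hVU hqV).1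
    obtain ⟨k2, l2⟩ := hF₂.lift q (hVU hqV).2
    rw [l1, l2]
    change _ = hopf (T.onTotal _)
    congr 1
    apply Subtype.ext
    have := hT (e q) (mem_chartDomain ⟨hqV, hVe hqV⟩)
    rwa [Function.comp_apply, Function.comp_apply, e.left_inv (hVe hqV)] at this
  · rintro T T' W hW hWV ⟨q, hq⟩ heq
    have g := g1.mono (isOpen_chartDomain e hW) fun w hw => ⟨hw.1, hWV hw.2⟩
    refine rigidMotion_act_eq g (mem_chartDomain ⟨hq, hVe (hWV hq)⟩) T T' fun w hw => ?_
    obtain ⟨k1, l1⟩ := hF₁.lift _ (hVU (hWV hw.2)).1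
    have := heq _ hw.2
    rw [l1] at this
    exact hopf_eq_iff.mp this

/-- Isometric Lagrangian immersions with the same mean curvature form and the same cubic
differential are congruent. -/
theorem IsAdmissible.congruent [ConnectedSpace S] (h₁ : IsAdmissible f Φ f₁)
    (h₂ : IsAdmissible f Φ f₂)
    (hq : ∀ e ∈ atlas ℂ S, Set.EqOn (cubicForm f₁ e) (cubicForm f₂ e) e.target) :
    Congruent f₁ f₂ := by
  obtain ⟨p₀⟩ := (inferInstance : Nonempty S)
  obtain ⟨V₀, hV₀, hp₀, ⟨T, hT⟩, -⟩ := h₁.local_congruent h₂ hq p₀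
  refine ⟨T, ?_⟩
  -- Near a limit point of A the local motion agrees with T on an open set, hence acts as T does. So
  -- A is closed as well as open.
  set A : Set S := {p | ∀ᶠ q in 𝓝 p, f₂ q = T.act (f₁ q)}
  have hAo : IsOpen A := isOpen_setOfPred_eventually_nhds
  have hAc : IsClosed A := by
    refine isClosed_of_closure_subset fun p hp => ?_
    obtain ⟨V, hV, hpV, ⟨T', hT'⟩, huniq⟩ := h₁.local_congruent h₂ hq p
    obtain ⟨q, hqV, hqA⟩ := mem_closure_iff.mp hp V hV hpV
    obtain ⟨W, hWs, hWo, hqW⟩ := eventually_nhds_iff.mp (hqA.and (hV.eventually_mem hqV))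
    have : T.act = T'.act := huniq T T' W hWo (fun x hx => (hWs x hx).2) ⟨q, hqW⟩
      fun x hx => by rw [← (hWs x hx).1, hT' x (hWs x hx).2]
    exact Filter.mem_of_superset (hV.mem_nhds hpV) fun x hx => by
      simp only [Set.mem_ofPred_eq]; rw [this]; exact hT' x hx
  have hA : A = Set.univ := IsClopen.eq_univ ⟨hAc, hAo⟩
    ⟨p₀, Filter.mem_of_superset (hV₀.mem_nhds hp₀) hT⟩
  intro p
  have : p ∈ A := hA ▸ Set.mem_univ p
  exact Filter.Eventually.self_of_nhds (p := fun q => f₂ q = T.act (f₁ q)) this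

end TwoImmersions
end Surface

/-! ### Holomorphic cubic differentials on compact Riemann surfaces -/

/-- A bounded univalent function on the complement of the segment `[2, 3]`. -/
def slitMap (m : ℂ) : ℂ := (1 + ((m - 2) / (m - 3)) ^ (2⁻¹ : ℂ))⁻¹

/-- The principal square root has nonnegative real part; this bounds the inverse in `slitMap`. -/
theorem one_le_re_slit (x : ℂ) : 1 ≤ (1 + x ^ (2⁻¹ : ℂ)).re := by
  rw [Complex.add_re, Complex.one_re, Complex.cpow_inv_two_re]
  linarith [Real.sqrt_nonneg ((‖x‖ + x.re) / 2)]

theorem one_add_slit_ne_zero (x : ℂ) : 1 + x ^ (2⁻¹ : ℂ) ≠ 0 := fun h => by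
  have := one_le_re_slit x
  rw [h, Complex.zero_re] at this
  linarith

theorem norm_slitMap_le (m : ℂ) : ‖slitMap m‖ ≤ 1 := by
  rw [slitMap, norm_inv]
  refine inv_le_one_of_one_le₀ ?_
  exact (one_le_re_slit _).trans (Complex.re_le_norm _)

/-- The Möbius map (m - 2)/(m - 3) carries the segment onto the closed negative axis with ∞, so its
complement lands where the principal root is holomorphic. -/
theorem slit_mem_slitPlane {m : ℂ} (hm : ∀ r : ℝ, 2 ≤ r → r ≤ 3 → m ≠ r) :
    (m - 2) / (m - 3) ∈ Complex.slitPlane := by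
  rw [Complex.mem_slitPlane_iff_not_le_zero]
  intro hle
  obtain ⟨h1, h2⟩ := Complex.le_def.mp hle
  set x := (m - 2) / (m - 3) with hx
  have hxr : x = (x.re : ℂ) := Complex.ext (by simp) (by simpa using h2)
  have hm3 : m - 3 ≠ 0 := fun h => hm 3 (by norm_num) le_rfl (by push_cast; linear_combination h)
  have h0 : x.re ≤ 0 := h1
  have hpos : 0 < 1 - x.re := by linarith
  have e1 : m - 2 = x.re * (m - 3) := by rw [← hxr, hx]; field_simp
  refine hm ((2 - 3 * x.re) / (1 - x.re)) ?_ ?_ ?_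
  · rw [le_div_iff₀ hpos]; linarith
  · rw [div_le_iff₀ hpos]; linarith
  · have hne : (1 - x.re : ℂ) ≠ 0 := by exact_mod_cast hpos.ne'
    push_cast
    rw [eq_div_iff hne]
    linear_combination e1

theorem differentiableAt_slitMap {m : ℂ} (hm : ∀ r : ℝ, 2 ≤ r → r ≤ 3 → m ≠ r) :
    DifferentiableAt ℂ slitMap m := by
  have hm3 : m - 3 ≠ 0 := fun h => hm 3 (by norm_num) le_rfl (by push_cast; linear_combination h)
  have h1 : DifferentiableAt ℂ (fun m : ℂ => (m - 2) / (m - 3)) m := by fun_prop (disch := exact hm3)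
  exact ((h1.cpow_const (slit_mem_slitPlane hm)).const_add 1).inv (one_add_slit_ne_zero _)

theorem slitMap_injOn {m m' : ℂ} (hm : m ≠ 3) (hm' : m' ≠ 3) (h : slitMap m = slitMap m') :
    m = m' := by
  have h1 := add_left_cancel (inv_injective h)
  have h2 := congrArg (fun x : ℂ => x ^ 2) h1
  simp only [Complex.cpow_ofNat_inv_pow] at h2
  have h3 : m - 3 ≠ 0 := sub_ne_zero.mpr hm
  have h4 : m' - 3 ≠ 0 := sub_ne_zero.mpr hm'
  rw [div_eq_div_iff h3 h4] at h2
  linear_combination -h2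

/-! ### Identity theorem and quotients of cubic differentials -/

section Surface

variable {S : Type*} [TopologicalSpace S] [ChartedSpace ℂ S]

/-- A holomorphic cubic differential, given by its coefficients in all coordinates. -/
structure IsCubicDifferential (h : OpenPartialHomeomorph S ℂ → ℂ → ℂ) : Prop where
  holomorphic : ∀ e ∈ atlas ℂ S, ∀ w ∈ e.target, DifferentiableAt ℂ (h e) w
  transition : ∀ e ∈ atlas ℂ S, ∀ e' ∈ atlas ℂ S, ∀ p ∈ e.source ∩ e'.source,
    h e (e p) = deriv (e' ∘ e.symm) (e p) ^ 3 * h e' (e' p)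

variable {h k : OpenPartialHomeomorph S ℂ → ℂ → ℂ}

theorem IsCubicDifferential.analyticAt (hh : IsCubicDifferential h)
    {e : OpenPartialHomeomorph S ℂ} (he : e ∈ atlas ℂ S) {w : ℂ} (hw : w ∈ e.target) :
    AnalyticAt ℂ (h e) w :=
  DifferentiableOn.analyticAt (s := e.target)
    (fun z hz => (hh.holomorphic e he z hz).differentiableWithinAt) (e.open_target.mem_nhds hw)

variable [IsManifold 𝓘(ℂ) ω S]

theorem IsCubicDifferential.eq_zero_iff (hh : IsCubicDifferential h)
    {e e' : OpenPartialHomeomorph S ℂ} (he : e ∈ atlas ℂ S) (he' : e' ∈ atlas ℂ S) {p : S}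
    (hp : p ∈ e.source) (hp' : p ∈ e'.source) : h e (e p) = 0 ↔ h e' (e' p) = 0 := by
  have h1 := deriv_transition_mul he he' hp hp'
  have hne : deriv (e' ∘ e.symm) (e p) ≠ 0 := fun h0 => by rw [h0, mul_zero] at h1; exact zero_ne_one h1
  rw [hh.transition e he e' he' p ⟨hp, hp'⟩]
  simp [hne]

/-- The identity theorem. -/
theorem IsCubicDifferential.eventually_ne_zero [ConnectedSpace S] (hh : IsCubicDifferential h)
    (hne : ∃ e ∈ atlas ℂ S, ∃ w ∈ e.target, h e w ≠ 0) {e : OpenPartialHomeomorph S ℂ}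
    (he : e ∈ atlas ℂ S) {w : ℂ} (hw : w ∈ e.target) : ∀ᶠ z in 𝓝[≠] w, h e z ≠ 0 := by
  -- The interior of the zero set is also closed: at a limit point outside it the zero would be
  -- isolated.
  set A : Set S := {p | ∀ᶠ q in 𝓝 p, ∀ e ∈ atlas ℂ S, q ∈ e.source → h e (e q) = 0}
  have hAo : IsOpen A := isOpen_setOfPred_eventually_nhds
  have hmem : ∀ e ∈ atlas ℂ S, ∀ p ∈ e.source, (∀ᶠ z in 𝓝 (e p), h e z = 0) → p ∈ A := by
    intro e he p hp hev
    have h1 := (e.continuousAt hp).eventually hev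
    filter_upwards [h1, e.open_source.eventually_mem hp] with q hq hqe e' he' hqe'
    exact (hh.eq_zero_iff he he' hqe hqe').mp hq
  have hAc : IsClosed A := by
    refine isClosed_of_closure_subset fun p hp => ?_
    have he₀ := chart_mem_atlas ℂ p
    have hpe := mem_chart_source ℂ p
    rcases (hh.analyticAt he₀ ((chartAt ℂ p).map_source hpe)).eventually_eq_zero_or_eventually_ne_zero
      with h0 | h0
    · exact hmem _ he₀ p hpe h0
    · rw [eventually_nhdsWithin_iff] at h0
      have h1 := ((chartAt ℂ p).continuousAt hpe).eventually h0
      obtain ⟨V, hVs, hVo, hpV⟩ := eventually_nhds_iff.mp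
        (h1.and ((chartAt ℂ p).open_source.eventually_mem hpe))
      obtain ⟨q, hqV, hqA⟩ := mem_closure_iff.mp hp V hVo hpV
      by_cases hqp : q = p
      · exact hqp ▸ hqA
      · exfalso
        obtain ⟨h2, h3⟩ := hVs q hqV
        refine h2 (fun h4 => hqp ((chartAt ℂ p).injOn h3 hpe h4)) ?_
        exact Filter.Eventually.self_of_nhds
          (p := fun q => ∀ e ∈ atlas ℂ S, q ∈ e.source → h e (e q) = 0) hqA _ he₀ h3
  rcases isClopen_iff.mp ⟨hAc, hAo⟩ with hA | hA
  · rcases (hh.analyticAt he hw).eventually_eq_zero_or_eventually_ne_zero with h0 | h0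
    · exfalso
      have : e.symm w ∈ A := hmem e he _ (e.map_target hw) (by rwa [e.right_inv hw])
      rw [hA] at this
      exact this
    · exact h0
  · obtain ⟨e', he', w', hw', hne'⟩ := hne
    exfalso
    have : e'.symm w' ∈ A := hA ▸ Set.mem_univ _
    have := Filter.Eventually.self_of_nhds
      (p := fun q => ∀ e ∈ atlas ℂ S, q ∈ e.source → h e (e q) = 0) this e' he' (e'.map_target hw')
    rw [e'.right_inv hw'] at this
    exact hne' this

/-- On a compact Riemann surface, the quotient of two cubic differentials which takes no value in a
segment is constant. -/
theorem IsCubicDifferential.exists_eq_const_mul [CompactSpace S] [ConnectedSpace S]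
    (hh : IsCubicDifferential h) (hk : IsCubicDifferential k)
    (hne : ∃ e ∈ atlas ℂ S, ∃ w ∈ e.target, h e w ≠ 0)
    (havoid : ∀ e ∈ atlas ℂ S, ∀ w ∈ e.target, ∀ r : ℝ, 2 ≤ r → r ≤ 3 → k e w = r * h e w →
      h e w = 0) :
    ∃ m : ℂ, ∀ e ∈ atlas ℂ S, ∀ w ∈ e.target, k e w = m * h e w := by
  let φ : OpenPartialHomeomorph S ℂ → ℂ → ℂ := fun e w => slitMap (k e w / h e w)
  have hφinv : ∀ e ∈ atlas ℂ S, ∀ e' ∈ atlas ℂ S, ∀ p ∈ e.source ∩ e'.source,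
      φ e (e p) = φ e' (e' p) := by
    intro e he e' he' p hp
    have h1 := deriv_transition_mul he he' hp.1 hp.2
    have hne : deriv (e' ∘ e.symm) (e p) ≠ 0 := fun h0 => by
      rw [h0, mul_zero] at h1; exact zero_ne_one h1
    simp only [φ]
    rw [hh.transition e he e' he' p hp, hk.transition e he e' he' p hp,
      mul_div_mul_left _ _ (pow_ne_zero 3 hne)]
  have hratio : ∀ e ∈ atlas ℂ S, ∀ w ∈ e.target, h e w ≠ 0 → ∀ r : ℝ, 2 ≤ r → r ≤ 3 →
      k e w / h e w ≠ r := fun e he w hw h0 r hr hr' heq =>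
    h0 (havoid e he w hw r hr hr' ((div_eq_iff h0).mp heq))
  have hφd : ∀ e ∈ atlas ℂ S, ∀ w ∈ e.target, h e w ≠ 0 → DifferentiableAt ℂ (φ e) w := by
    intro e he w hw h0
    exact DifferentiableAt.comp (g := slitMap) w (differentiableAt_slitMap (hratio e he w hw h0))
      ((hk.holomorphic e he w hw).div (hh.holomorphic e he w hw) h0)
  -- Taking limits extends φ across the zeros of h, where the quotient has only a junk value.
  let R : S → ℂ := fun p => Filter.limUnder (𝓝[≠] (chartAt ℂ p p)) (φ (chartAt ℂ p))
  have hR : ∀ e ∈ atlas ℂ S, ∀ p ∈ e.source, h e (e p) ≠ 0 → R p = φ e (e p) := by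
    intro e he p hp h0
    have he₀ := chart_mem_atlas ℂ p
    have hpe := mem_chart_source ℂ p
    have h1 : h (chartAt ℂ p) (chartAt ℂ p p) ≠ 0 := fun h2 =>
      h0 ((hh.eq_zero_iff he he₀ hp hpe).mpr h2)
    rw [hφinv e he _ he₀ p ⟨hp, hpe⟩]
    have hc := (hφd _ he₀ _ ((chartAt ℂ p).map_source hpe) h1).continuousAt
    exact (hc.tendsto.mono_left nhdsWithin_le_nhds).limUnder_eq
  have hRd : MDifferentiable 𝓘(ℂ) 𝓘(ℂ) R := by
    intro p
    set e := chartAt ℂ p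
    have he : e ∈ atlas ℂ S := chart_mem_atlas ℂ p
    have hpe : p ∈ e.source := mem_chart_source ℂ p
    have hev := hh.eventually_ne_zero hne he (e.map_source hpe)
    rw [eventually_nhdsWithin_iff] at hev
    have hev2 := hev.and (e.open_target.eventually_mem (e.map_source hpe))
    obtain ⟨s, hs, hso, hps⟩ := eventually_nhds_iff.mp hev2
    have hsn := hso.mem_nhds hps
    have hd : DifferentiableOn ℂ (φ e) (s \ {e p}) := fun w hw =>
      (hφd e he w (hs w hw.1).2 ((hs w hw.1).1 hw.2)).differentiableWithinAt
    -- Riemann's removable singularity theorem, available since `slitMap` is bounded by 1.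
    have hg := Complex.differentiableOn_update_limUnder_of_bddAbove hsn hd
      ⟨1, by rintro _ ⟨w, _, rfl⟩; exact norm_slitMap_le _⟩
    have hgd := hg.differentiableAt hsn
    have hem : MDifferentiableAt 𝓘(ℂ) 𝓘(ℂ) e p := by
      have : IsManifold 𝓘(ℂ) 1 S := IsManifold.of_le (n := ω) le_top
      exact mdifferentiableAt_atlas he hpe
    refine (hgd.mdifferentiableAt.comp p hem).congr_of_eventuallyEq ?_
    filter_upwards [(e.continuousAt hpe).eventually hsn, e.open_source.eventually_mem hpe] with q hq hqe
    by_cases hqp : q = p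
    · subst hqp
      simp [R, e]
    · have hne' : e q ≠ e p := fun h4 => hqp (e.injOn hqe hpe h4)
      rw [Function.comp_apply, Function.update_of_ne hne']
      exact hR e he q hqe ((hs _ hq).1 hne')
  -- By the maximum principle R is constant; injectivity of `slitMap` then makes k/h constant away
  -- from the zeros of h, and continuity covers the zeros.
  obtain ⟨C, hC⟩ := hRd.exists_eq_const_of_compactSpace
  obtain ⟨e₀, he₀, w₀, hw₀, hne₀⟩ := id hne
  have hval : ∀ e ∈ atlas ℂ S, ∀ w ∈ e.target, h e w ≠ 0 → slitMap (k e w / h e w) = C := by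
    intro e he w hw h0
    have := hR e he _ (e.map_target hw) (by rwa [e.right_inv hw])
    rw [hC, e.right_inv hw] at this
    exact this.symm
  have h3 : ∀ e ∈ atlas ℂ S, ∀ w ∈ e.target, h e w ≠ 0 → k e w / h e w ≠ 3 :=
    fun e he w hw h0 => by
      have := hratio e he w hw h0 3 (by norm_num) le_rfl
      exact_mod_cast this
  have hmain : ∀ e ∈ atlas ℂ S, ∀ w ∈ e.target, h e w ≠ 0 → k e w = k e₀ w₀ / h e₀ w₀ * h e w := by
    intro e he w hw h0
    have := slitMap_injOn (h3 e he w hw h0) (h3 e₀ he₀ w₀ hw₀ hne₀)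
      ((hval e he w hw h0).trans (hval e₀ he₀ w₀ hw₀ hne₀).symm)
    rw [← this, div_mul_cancel₀ _ h0]
  refine ⟨k e₀ w₀ / h e₀ w₀, fun e he w hw => ?_⟩
  have hev : ∀ᶠ z in 𝓝[≠] w, k e z = k e₀ w₀ / h e₀ w₀ * h e z := by
    filter_upwards [hh.eventually_ne_zero hne he hw,
      nhdsWithin_le_nhds (e.open_target.mem_nhds hw)] with z hz hzt
    exact hmain e he z hzt hz
  have t1 := (hk.holomorphic e he w hw).continuousAt.tendsto.mono_left
    (nhdsWithin_le_nhds (s := {w}ᶜ))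
  have t2 := ((hh.holomorphic e he w hw).continuousAt.tendsto.mono_left
    (nhdsWithin_le_nhds (s := {w}ᶜ))).const_mul (k e₀ w₀ / h e₀ w₀)
  exact tendsto_nhds_unique t1 (t2.congr' (hev.mono fun z hz => hz.symm))

end Surface

/-! ### At most two isometric Lagrangian immersions with a given mean curvature form -/

section Surface

variable {S : Type*} [TopologicalSpace S] [ChartedSpace ℂ S] [IsManifold 𝓘(ℂ) ω S] {c : SignType}

theorem IsAdmissible.isCubicDifferential_sub {f f₁ f₂ : S → SpaceForm c}
    {Φ : ∀ p : S, TangentSpace 𝓘(ℂ) p →L[ℂ] ℂ} (h₁ : IsAdmissible f Φ f₁)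
    (h₂ : IsAdmissible f Φ f₂) :
    IsCubicDifferential fun e w => cubicForm f₁ e w - cubicForm f₂ e w :=
  ⟨fun _ he _ hw => (h₁.cubicForm_compare h₂ he hw).2, fun e he e' he' p hp => by
    rw [h₁.cubicForm_transition he he' hp.1 hp.2, h₂.cubicForm_transition he he' hp.1 hp.2]
    ring⟩

theorem re_of_normSq_sub {q h : ℂ} (H : Complex.normSq q = Complex.normSq (q - h)) :
    2 * (q.re * h.re + q.im * h.im) = Complex.normSq h := by
  simp only [Complex.normSq_apply, Complex.sub_re, Complex.sub_im] at H ⊢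
  linarith

/-- The heart of the argument: with h = Q₁ - Q₂ and k = Q₁ - Q₃, equal lengths restrict k/h so
strongly that it is constant, and a nonreal constant would make Q₁ holomorphic. -/
theorem IsAdmissible.congruent_of_three [CompactSpace S] [ConnectedSpace S]
    {f f₁ f₂ f₃ : S → SpaceForm c} {Φ : ∀ p : S, TangentSpace 𝓘(ℂ) p →L[ℂ] ℂ}
    (h₀ : IsAdmissible f Φ f) (hmaslov : ¬ HasConformalMaslovForm f)
    (h₁ : IsAdmissible f Φ f₁) (h₂ : IsAdmissible f Φ f₂) (h₃ : IsAdmissible f Φ f₃) :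
    Congruent f₁ f₂ ∨ Congruent f₁ f₃ ∨ Congruent f₂ f₃ := by
  by_cases hne : ∃ e ∈ atlas ℂ S, ∃ w ∈ e.target, cubicForm f₁ e w - cubicForm f₂ e w ≠ 0
  swap
  · push Not at hne
    exact Or.inl (h₁.congruent h₂ fun e he w hw => sub_eq_zero.mp (hne e he w hw))
  have H2 : ∀ e ∈ atlas ℂ S, ∀ w ∈ e.target,
      2 * ((cubicForm f₁ e w).re * (cubicForm f₁ e w - cubicForm f₂ e w).re +
        (cubicForm f₁ e w).im * (cubicForm f₁ e w - cubicForm f₂ e w).im) =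
      Complex.normSq (cubicForm f₁ e w - cubicForm f₂ e w) := fun e he w hw => by
    refine re_of_normSq_sub ?_
    rw [(h₁.cubicForm_compare h₂ he hw).1, sub_sub_cancel]
  have H3 : ∀ e ∈ atlas ℂ S, ∀ w ∈ e.target,
      2 * ((cubicForm f₁ e w).re * (cubicForm f₁ e w - cubicForm f₃ e w).re +
        (cubicForm f₁ e w).im * (cubicForm f₁ e w - cubicForm f₃ e w).im) =
      Complex.normSq (cubicForm f₁ e w - cubicForm f₃ e w) := fun e he w hw => by
    refine re_of_normSq_sub ?_
    rw [(h₁.cubicForm_compare h₃ he hw).1, sub_sub_cancel]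
  -- Substituting k = rh in 2 Re(Q₁ k̄) = |k|² gives r|h|² = r²|h|².
  have hreal : ∀ e ∈ atlas ℂ S, ∀ w ∈ e.target, ∀ r : ℝ,
      cubicForm f₁ e w - cubicForm f₃ e w = r * (cubicForm f₁ e w - cubicForm f₂ e w) →
      cubicForm f₁ e w - cubicForm f₂ e w ≠ 0 → r = 0 ∨ r = 1 := by
    intro e he w hw r hr h0
    have k2 := H2 e he w hw
    have k3 := H3 e he w hw
    rw [hr, Complex.normSq_mul, Complex.normSq_ofReal, Complex.re_ofReal_mul,
      Complex.im_ofReal_mul] at k3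
    have hpos : Complex.normSq (cubicForm f₁ e w - cubicForm f₂ e w) ≠ 0 :=
      Complex.normSq_eq_zero.not.mpr h0
    have : r * (r - 1) * Complex.normSq (cubicForm f₁ e w - cubicForm f₂ e w) = 0 := by
      linear_combination r * k2 - k3
    rcases mul_eq_zero.mp ((mul_eq_zero.mp this).resolve_right hpos) with h | h
    · exact Or.inl h
    · exact Or.inr (by linarith)
  obtain ⟨m, hm⟩ := (h₁.isCubicDifferential_sub h₂).exists_eq_const_mul
    (h₁.isCubicDifferential_sub h₃) hne fun e he w hw r hr hr' heq => by
      by_contra h0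
      rcases hreal e he w hw r heq h0 with h | h <;> linarith
  by_cases him : m.im = 0
  · have hmr : m = (m.re : ℂ) := Complex.ext (by simp) (by simpa using him)
    obtain ⟨e, he, w, hw, h0⟩ := hne
    have hm' := hm e he w hw
    rw [hmr] at hm'
    rcases hreal e he w hw m.re hm' h0 with h | h
    · refine Or.inr (Or.inl (h₁.congruent h₃ fun e he w hw => sub_eq_zero.mp ?_))
      rw [hm e he w hw, hmr, h, Complex.ofReal_zero, zero_mul]
    · refine Or.inr (Or.inr (h₂.congruent h₃ fun e he w hw => ?_))
      have := hm e he w hw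
      rw [hmr, h, Complex.ofReal_one, one_mul] at this
      linear_combination this
  · exfalso
    -- The first equation gives Q₁ h̄ = |h|²(1/2 + is) with s real. Inserted into the one for k = mh
    -- it yields Re m + 2s Im m = |m|², so s = t at every point where h ≠ 0.
    set t : ℝ := (Complex.normSq m - m.re) / (2 * m.im)
    have hpt : ∀ e ∈ atlas ℂ S, ∀ w ∈ e.target, cubicForm f₁ e w - cubicForm f₂ e w ≠ 0 →
        cubicForm f₁ e w = (1 / 2 + t * Complex.I) * (cubicForm f₁ e w - cubicForm f₂ e w) := by
      intro e he w hw h0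
      have k2 := H2 e he w hw
      have k3 := H3 e he w hw
      rw [hm e he w hw, Complex.normSq_mul, Complex.mul_re, Complex.mul_im] at k3
      generalize cubicForm f₁ e w - cubicForm f₂ e w = h at k2 k3 h0 ⊢
      generalize cubicForm f₁ e w = q at k2 k3 ⊢
      have ht : t * (2 * m.im) = Complex.normSq m - m.re := by
        simp only [t]; field_simp
      have hB : q.im * h.re - q.re * h.im = t * Complex.normSq h := by
        have h2 : 2 * m.im ≠ 0 := mul_ne_zero two_ne_zero him
        apply mul_left_cancel₀ h2
        linear_combination k3 - m.re * k2 - Complex.normSq h * ht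
      have hc : conj h ≠ 0 := (map_ne_zero _).mpr h0
      apply mul_right_cancel₀ hc
      rw [mul_assoc, Complex.mul_conj]
      apply Complex.ext
      · simp; linarith
      · simp; linarith
    have hev : ∀ e ∈ atlas ℂ S, ∀ w ∈ e.target,
        cubicForm f₁ e w = (1 / 2 + t * Complex.I) * (cubicForm f₁ e w - cubicForm f₂ e w) := by
      intro e he w hw
      -- The zeros of h are isolated, so the identity extends to them by continuity.
      have hq := h₁.continuousAt_cubicForm he hw
      have hd := (h₁.cubicForm_compare h₂ he hw).2.continuousAt
      refine tendsto_nhds_unique (hq.tendsto.mono_left (nhdsWithin_le_nhds (s := {w}ᶜ)))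
        (Filter.Tendsto.congr' ?_
          ((hd.tendsto.mono_left (nhdsWithin_le_nhds (s := {w}ᶜ))).const_mul
            (1 / 2 + t * Complex.I)))
      filter_upwards [(h₁.isCubicDifferential_sub h₂).eventually_ne_zero hne he hw,
        nhdsWithin_le_nhds (e.open_target.mem_nhds hw)] with z hz hzt
      exact (hpt e he z hzt hz).symm
    refine hmaslov (h₀.hasConformalMaslovForm h₁ fun e he w hw => ?_)
    refine ((h₁.cubicForm_compare h₂ he hw).2.const_mul
      (1 / 2 + t * Complex.I)).congr_of_eventuallyEq ?_
    filter_upwards [e.open_target.mem_nhds hw] with z hz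
    exact hev e he z hz

end Surface

end LagrangianBonnet

end

theorem mainTheorem1 (c : SignType) {S : Type*} [TopologicalSpace S] [T2Space S]
    [CompactSpace S] [ConnectedSpace S] [ChartedSpace ℂ S] [IsManifold 𝓘(ℂ) ω S]
    (f : S → LagrangianBonnet.SpaceForm c)
    (hf : LagrangianBonnet.IsLagrangianImmersion f)
    (hconf : LagrangianBonnet.IsConformal f)
    (Φ : ∀ p : S, TangentSpace 𝓘(ℂ) p →L[ℂ] ℂ)
    (hΦ : LagrangianBonnet.HasMeanCurvatureForm f Φ)
    (hmaslov : ¬ LagrangianBonnet.HasConformalMaslovForm f) :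
    (∀ f₁ f₂ f₃ : S → LagrangianBonnet.SpaceForm c,
      LagrangianBonnet.IsIsometricLagrangianWith f Φ f₁ →
      LagrangianBonnet.IsIsometricLagrangianWith f Φ f₂ →
      LagrangianBonnet.IsIsometricLagrangianWith f Φ f₃ →
      LagrangianBonnet.Congruent f₁ f₂ ∨ LagrangianBonnet.Congruent f₁ f₃ ∨
        LagrangianBonnet.Congruent f₂ f₃) ∧
    (∀ f₁ f₂ : S → LagrangianBonnet.SpaceForm c,
      LagrangianBonnet.IsBonnetPartner f Φ f₁ →
      LagrangianBonnet.IsBonnetPartner f Φ f₂ →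
      LagrangianBonnet.Congruent f₁ f₂) := by
  have h₀ := LagrangianBonnet.isAdmissible_self hf hconf hΦ
  refine ⟨fun f₁ f₂ f₃ h₁ h₂ h₃ => ?_, fun f₁ f₂ h₁ h₂ => ?_⟩
  · exact h₀.congruent_of_three hmaslov (h₁.isAdmissible hf hconf) (h₂.isAdmissible hf hconf)
      (h₃.isAdmissible hf hconf)
  -- The triple is f itself and its two partners; noncongruence with f leaves one alternative.
  · rcases h₀.congruent_of_three hmaslov h₀ (h₁.toIsIsometricLagrangianWith.isAdmissible hf hconf)
      (h₂.toIsIsometricLagrangianWith.isAdmissible hf hconf) with h | h | h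
    · exact absurd h h₁.noncongruent
    · exact absurd h h₂.noncongruent
    · exact h
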